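/- An input-driven double-head pushdown automaton (IDDHPDA) consists of a finite set $Q$ of states with an initial state $q_0$ and a set $F\subseteq Q$ of accepting states, a finite input alphabet $\Sigma$ partitioned into $\Sigma_D$ (push), $\Sigma_R$ (pop) and $\Sigma_N$ (state change only), a finite pushdown alphabet $\Gamma$, and transition functions. A configuration consists of a state, the unread part of the input, and the pushdown content. In one step the automaton consumes either the first symbol (left head) or the last symbol (right head) of the unread input; the class of this symbol determines whether a pushdown symbol is pushed, the topmost symbol is popped (popping from the empty pushdown leaves it empty), or the pushdown is left unchanged. The possible moves depend on the state, the head moved, the symbol it reads, and the topmost pushdown symbol, or the marker $\bot\notin\Gamma$ if the pushdown is empty. The language $L(M)$ consists of the input words on which some computation starting in $q_0$ with empty pushdown reads the whole input and ends in a state of $F$, with any pushdown content. $M$ is deterministic (a DIDDHPDA) if in every configuration there is at most one choice of action (head and transition). Automata are given as problem instances by finite descriptions; a problem is semidecidable if the set of instances with answer "yes" is recursively enumerable. A Turing machine here is a deterministic one with one tape that is infinite to the right; it halts whenever it enters an accepting state, and it cannot print blanks. Let $Q$ be its finite set of states and $T$ its finite set of tape symbols, containing the input symbols and the blank, which is not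 an input symbol. An instantaneous description (ID) is a word $t\,q\,t'\in T^*QT^*$, meaning that the state is $q$, the tape contains $tt'$ followed by blanks, and the head scans the first symbol of $t'$ (a blank if $t'$ is empty). An initial ID is $q_0x$ with $q_0$ the initial state and $x$ an input word; an ID is accepting if its state is accepting. The set $\mathrm{VALC}(M)$ of valid computations of $M$ is the set of all words $$w_0\,\#\,w_2\,\#\cdots\#\,w_{2n}\,\$\,w_{2n+1}^R\,\#\cdots\#\,w_3^R\,\#\,w_1^R$$ over $T\cup Q\cup\{\#,\$\}$ (a disjoint union), where $n\ge 0$, the $w_i$ are IDs of $M$, $w_0$ is initial, $w_{2n+1}$ is accepting, and $w_{i+1}$ is the successor of $w_i$ for $0\le i\le 2n$. **Theorem.** 1. It is not semidecidable, given two DIDDHPDAs $M_1$ and $M_2$, whether $L(M_1)\cap L(M_2)=\emptyset$. 2. It is not semidecidable, given two DIDDHPDAs $M_1$ and $M_2$, whether $L(M_1)\subseteq L(M_2)$. 3. For every such Turing machine $M$ there are languages $L_1$ and $L_2$, each accepted by a DIDDHPDA with input alphabet $T\cup Q\cup\{\#,\$\}$, such that $\mathrm{VALC}(M)=L_1\cap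 L_2$. -/

import Mathlib

namespace DoubleHead

/-- The action on the pushdown store that an input symbol enforces:
`push` (class `Σ_D`), `pop` (class `Σ_R`), or `keep` (class `Σ_N`, state change only). -/
inductive Act where
  | push
  | pop
  | keep

/-- The two input heads; the left head moves to the right, the right head moves to the left. -/
inductive Head where
  | left
  | right

/-- A nondeterministic input-driven double-head pushdown automaton (IDDHPDA) with states `Q`,
input symbols `A` and pushdown symbols `G`.  The signature `sig` is the partition of `A` into
push, pop and keep symbols.  The top-of-pushdown argument is `none` for the empty pushdown
symbol `⊥` and `some z` for `z : G`.  Since in every step exactly one head moves, the pair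
`(a, λ)` of arguments of a transition function is written `Head.left, a` and the pair `(λ, a)`
is written `Head.right, a`.  A transition function that is undefined has the value `∅`. -/
structure IDDHPDA (Q A G : Type) where
  sig : A → Act
  start : Q
  accept : Set Q
  pushTrans : Q → Head → {a : A // sig a = Act.push} → Option G → Set (Q × G)
  popTrans : Q → Head → {a : A // sig a = Act.pop} → Option G → Set Q
  keepTrans : Q → Head → {a : A // sig a = Act.keep} → Option G → Set Q

namespace IDDHPDA

variable {Q A G : Type}

/-- A configuration: the current state, the unread part of the input, and the pushdown content
(top of the pushdown first). -/
structure Config (Q A G : Type) where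
  state : Q
  unread : List A
  stack : List G

/-- `M.Step h c c'`: the automaton can go from `c` to `c'` in one step by moving head `h`.
Here `s.head?` is the topmost pushdown symbol, or `none` (that is, `⊥`) if `s` is empty; popping
from the empty pushdown leaves it empty. -/
inductive Step (M : IDDHPDA Q A G) : Head → Config Q A G → Config Q A G → Prop
  | pushLeft {q q' : Q} {a : A} {w : List A} {s : List G} {z' : G} (ha : M.sig a = Act.push)
      (h : (q', z') ∈ M.pushTrans q Head.left ⟨a, ha⟩ s.head?) :
      Step M Head.left ⟨q, a :: w, s⟩ ⟨q', w, z' :: s⟩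
  | pushRight {q q' : Q} {a : A} {w : List A} {s : List G} {z' : G} (ha : M.sig a = Act.push)
      (h : (q', z') ∈ M.pushTrans q Head.right ⟨a, ha⟩ s.head?) :
      Step M Head.right ⟨q, w ++ [a], s⟩ ⟨q', w, z' :: s⟩
  | popLeft {q q' : Q} {a : A} {w : List A} {s : List G} (ha : M.sig a = Act.pop)
      (h : q' ∈ M.popTrans q Head.left ⟨a, ha⟩ s.head?) :
      Step M Head.left ⟨q, a :: w, s⟩ ⟨q', w, s.tail⟩
  | popRight {q q' : Q} {a : A} {w : List A} {s : List G} (ha : M.sig a = Act.pop)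
      (h : q' ∈ M.popTrans q Head.right ⟨a, ha⟩ s.head?) :
      Step M Head.right ⟨q, w ++ [a], s⟩ ⟨q', w, s.tail⟩
  | keepLeft {q q' : Q} {a : A} {w : List A} {s : List G} (ha : M.sig a = Act.keep)
      (h : q' ∈ M.keepTrans q Head.left ⟨a, ha⟩ s.head?) :
      Step M Head.left ⟨q, a :: w, s⟩ ⟨q', w, s⟩
  | keepRight {q q' : Q} {a : A} {w : List A} {s : List G} (ha : M.sig a = Act.keep)
      (h : q' ∈ M.keepTrans q Head.right ⟨a, ha⟩ s.head?) :
      Step M Head.right ⟨q, w ++ [a], s⟩ ⟨q', w, s⟩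

/-- The accepted language: some computation from the initial configuration reads the whole input
and ends in an accepting state, with any pushdown content. -/
def language (M : IDDHPDA Q A G) : Set (List A) :=
  {w | ∃ q ∈ M.accept, ∃ s : List G,
    Relation.ReflTransGen (fun c c' => ∃ h, M.Step h c c') ⟨M.start, w, []⟩ ⟨q, [], s⟩}

/-- Determinism: in every configuration there is at most one choice of action.  A choice of
action is the choice of the head to be moved together with the choice of a transition; for a given
configuration and head, the latter is determined by the successor configuration. -/
def Deterministic (M : IDDHPDA Q A G) : Prop :=
  ∀ c h₁ h₂ c₁ c₂, M.Step h₁ c c₁ → M.Step h₂ c c₂ → h₁ = h₂ ∧ c₁ = c₂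

end IDDHPDA

/-- `L` is accepted by a deterministic IDDHPDA (a DIDDHPDA). -/
def AcceptedByDet {A : Type} (L : Set (List A)) : Prop :=
  ∃ (Q G : Type) (_ : Finite Q) (_ : Finite G) (M : IDDHPDA Q A G),
    M.Deterministic ∧ M.language = L

/-! ### Finite descriptions of automata, as instances of decision problems -/

/-- The three actions are enumerated as `push, pop, keep`. -/
def actEquiv : Act ≃ Fin 3 where
  toFun
    | .push => 0
    | .pop => 1
    | .keep => 2
  invFun := ![.push, .pop, .keep]
  left_inv a := by cases a <;> rfl
  right_inv i := by fin_cases i <;> rfl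

/-- The two heads are enumerated as `left, right`. -/
def headEquiv : Head ≃ Bool where
  toFun
    | .left => false
    | .right => true
  invFun b := bif b then .right else .left
  left_inv h := by cases h <;> rfl
  right_inv b := by cases b <;> rfl

instance : Primcodable Act := Primcodable.ofEquiv (Fin 3) actEquiv

instance : Primcodable Head := Primcodable.ofEquiv Bool headEquiv

/-- A finite description of an IDDHPDA: the states are `0, …, lastState`, the initial state is
`0`, the input symbols are `0, …, sig.length - 1`, the symbol `a` having the action `sig[a]`, the
pushdown symbols are `0, …, stackSize - 1`, and the accepting states and the three transition
functions are given by tables.  A table entry `(q, h, a, z, p, y)` of `pushTable` says that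
`(p, y)` is a possible move, `(q, h, a, z, p)` in the other two tables says that `p` is one. -/
structure Desc where
  lastState : ℕ
  stackSize : ℕ
  sig : List Act
  accept : List ℕ
  pushTable : List (ℕ × Head × ℕ × Option ℕ × ℕ × ℕ)
  popTable : List (ℕ × Head × ℕ × Option ℕ × ℕ)
  keepTable : List (ℕ × Head × ℕ × Option ℕ × ℕ)

namespace Desc

/-- A description as the tuple of its fields. -/
def equivProd : Desc ≃ ℕ × ℕ × List Act × List ℕ ×
    List (ℕ × Head × ℕ × Option ℕ × ℕ × ℕ) × List (ℕ × Head × ℕ × Option ℕ × ℕ) ×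
    List (ℕ × Head × ℕ × Option ℕ × ℕ) where
  toFun d := (d.lastState, d.stackSize, d.sig, d.accept, d.pushTable, d.popTable, d.keepTable)
  invFun t := ⟨t.1, t.2.1, t.2.2.1, t.2.2.2.1, t.2.2.2.2.1, t.2.2.2.2.2.1, t.2.2.2.2.2.2⟩
  left_inv _ := rfl
  right_inv _ := rfl

instance : Primcodable Desc := Primcodable.ofEquiv _ equivProd

/-- The automaton that a description describes.  (Table entries that mention a state or symbol
out of range, or an input symbol of the wrong class, have no effect.) -/
def toAutomaton (d : Desc) :
    IDDHPDA (Fin (d.lastState + 1)) (Fin d.sig.length) (Fin d.stackSize) where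
  sig a := d.sig.get a
  start := 0
  accept := {q | q.val ∈ d.accept}
  pushTrans q h a z :=
    {p | (q.val, h, a.val.val, z.map Fin.val, p.1.val, p.2.val) ∈ d.pushTable}
  popTrans q h a z := {p | (q.val, h, a.val.val, z.map Fin.val, p.val) ∈ d.popTable}
  keepTrans q h a z := {p | (q.val, h, a.val.val, z.map Fin.val, p.val) ∈ d.keepTable}

/-- The described automaton is deterministic, that is, `d` describes a DIDDHPDA. -/
def Deterministic (d : Desc) : Prop := d.toAutomaton.Deterministic

/-- The language of the described automaton, as a set of words over the natural numbers, so that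
automata with different input alphabets `{0, …, k - 1}` can be compared. -/
def language (d : Desc) : Set (List ℕ) :=
  {w | ∃ u ∈ d.toAutomaton.language, u.map Fin.val = w}

end Desc

/-- A decision problem with the given instances and the given question is semidecidable if the set
of all instances for which the answer is "yes" is recursively enumerable. -/
def Semidecidable {I : Type} [Primcodable I] (isInstance question : I → Prop) : Prop :=
  REPred fun x => isInstance x ∧ question x

/-! ### Turing machines and their valid computations -/

/-- Moves of the head of a Turing machine. -/
inductive Dir where
  | left
  | right

/-- A deterministic Turing machine with states `Q` and tape symbols `T`, working on a tape that is
infinite to the right only.  It halts when it enters an accepting state and cannot print blanks. -/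
structure TM (Q T : Type) where
  input : Set T
  blank : T
  blank_notMem_input : blank ∉ input
  trans : Q → T → Option (Q × T × Dir)
  start : Q
  final : Set Q
  halt_of_final : ∀ q ∈ final, ∀ a, trans q a = none
  print_ne_blank : ∀ q a p b d, trans q a = some (p, b, d) → b ≠ blank

/-- The alphabet `T ∪ Q ∪ {#, $}` (a disjoint union). -/
inductive CompSymbol (Q T : Type) where
  | tape (a : T)
  | state (q : Q)
  | border
  | dollar

/-- An instantaneous description `t q t'`: the state is `q`, the tape content is `t t'` followed by
blanks, and the head scans the first symbol of `t'` (a blank if `t'` is empty). -/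
structure ID (Q T : Type) where
  before : List T
  state : Q
  after : List T

/-- The word `t q t'`. -/
def ID.word {Q T : Type} (c : ID Q T) : List (CompSymbol Q T) :=
  c.before.map CompSymbol.tape ++ CompSymbol.state c.state :: c.after.map CompSymbol.tape

namespace TM

variable {Q T : Type}

/-- `M.Next c c'`: `c'` is the successor configuration of `c`.  There is no move to the left from
the leftmost cell. -/
inductive Next (M : TM Q T) : ID Q T → ID Q T → Prop
  | moveRight {q p : Q} {b : T} {l r : List T}
      (h : M.trans q (r.headD M.blank) = some (p, b, Dir.right)) :
      Next M ⟨l, q, r⟩ ⟨l ++ [b], p, r.tail⟩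
  | moveLeft {q p : Q} {b c : T} {l r : List T}
      (h : M.trans q (r.headD M.blank) = some (p, b, Dir.left)) :
      Next M ⟨l ++ [c], q, r⟩ ⟨l, p, c :: b :: r.tail⟩

/-- The initial IDs `q₀ x` with an input word `x`. -/
def IsInitial (M : TM Q T) (c : ID Q T) : Prop :=
  c.before = [] ∧ c.state = M.start ∧ ∀ a ∈ c.after, a ∈ M.input

/-- The set of valid computations, that is, of all words
`w₀ # w₂ # ⋯ # w₂ₙ $ w₂ₙ₊₁ᴿ # ⋯ # w₃ᴿ # w₁ᴿ` where `w₀` is an initial ID, `w₂ₙ₊₁` is an accepting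
ID, and `wᵢ₊₁` is the successor configuration of `wᵢ` for `0 ≤ i ≤ 2n`. -/
def validComputations (M : TM Q T) : Set (List (CompSymbol Q T)) :=
  {v | ∃ (n : ℕ) (w : ℕ → ID Q T),
    M.IsInitial (w 0) ∧ (w (2 * n + 1)).state ∈ M.final ∧
    (∀ i ≤ 2 * n, M.Next (w i) (w (i + 1))) ∧
    v = [CompSymbol.border].intercalate
          ((List.range (n + 1)).map fun i => (w (2 * i)).word) ++
        CompSymbol.dollar :: [CompSymbol.border].intercalate
          ((List.range (n + 1)).reverse.map fun i => (w (2 * i + 1)).word.reverse)}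

end TM

end DoubleHead

/-! The pushdown is never needed: every symbol gets the action `keep`, and the state alone decides
which head moves (`HeadDFA`). The right half of a valid computation is reversed and nested around
the left half. A left head in `uᵢ` and a right head in `vᵢ` can therefore read two IDs in lockstep.
An ID and its successor differ only in a window around the state, so finite memory suffices to
compare them (`syncRun_copy`).

One automaton, `leftToRight`, checks every step `uᵢ ⊢ vᵢ`. The other, `rightToLeft`, first runs over
`u₀` with the left head, checking that it is initial. It is then shifted by one block, checks every
step `vᵢ ⊢ uᵢ₊₁`, and finally checks that the states in `vₙ` are accepting. The separators make the
decomposition into blocks unique (`Nest.inter`), so the intersection of the two languages consists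
of the valid computations (`leftToRight_inter_rightToLeft`, `nest_iff_interleavedWord`). This is the
third claim.

For undecidability the same construction is applied to one fixed machine on a two-way infinite tape,
with the instance `m` encoded in its input `a b cᵐ` (`exists_machine_not_re`). The initial ID is
padded with arbitrarily many blanks on both sides: a halting run uses finitely many cells, so some
padding suffices (`exists_nest_iff_eval_dom`). Only the automaton for initial IDs depends on `m`,
and its table is primitive recursive in `m` (`exists_describedBy_padded`). The intersection is empty
exactly if the machine does not halt, and the set of such `m` is not recursively enumerable.

Inclusion follows from disjointness, because `HeadDFA`s are closed under complement
(`HeadDFA.compl`): `L₁ ∩ L₂ = ∅` says that `L₂` is contained in the complement of `L₁`. -/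

namespace DoubleHead

/-! ### Double-head finite automata -/

/-- A deterministic automaton without pushdown whose state determines the head to be moved. -/
structure HeadDFA (S A : Type) where
  head : S → Head
  next : S → A → S → Prop
  next_unique : ∀ {s a t t'}, next s a t → next s a t' → t = t'
  start : S
  accept : Set S

namespace HeadDFA

variable {S A : Type}

/-- `D.Accepts s w`: started in the state `s`, the automaton reads `w` and ends in an accepting
state. -/
inductive Accepts (D : HeadDFA S A) : S → List A → Prop
  | nil {s} : s ∈ D.accept → Accepts D s []
  | left {s a t w} : D.head s = Head.left → D.next s a t → Accepts D t w → Accepts D s (a :: w)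
  | right {s a t w} : D.head s = Head.right → D.next s a t → Accepts D t w →
      Accepts D s (w ++ [a])

/-- The words accepted from the initial state. -/
def language (D : HeadDFA S A) : Set (List A) := {w | D.Accepts D.start w}

variable {D : HeadDFA S A} {s : S}

theorem accepts_nil : D.Accepts s [] ↔ s ∈ D.accept := by
  constructor
  · intro h
    generalize hw : ([] : List A) = w at h
    cases h with
    | nil h => exact h
    | left => cases hw
    | right => simp at hw
  · exact Accepts.nil

theorem accepts_cons (hs : D.head s = Head.left) {a : A} {w : List A} :
    D.Accepts s (a :: w) ↔ ∃ t, D.next s a t ∧ D.Accepts t w := by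
  constructor
  · intro h
    generalize hw : a :: w = v at h
    cases h with
    | nil h => cases hw
    | left _ h1 h2 => cases hw; exact ⟨_, h1, h2⟩
    | right h => simp [hs] at h
  · rintro ⟨t, h1, h2⟩
    exact Accepts.left hs h1 h2

theorem accepts_concat (hs : D.head s = Head.right) {a : A} {w : List A} :
    D.Accepts s (w ++ [a]) ↔ ∃ t, D.next s a t ∧ D.Accepts t w := by
  constructor
  · intro h
    generalize hw : w ++ [a] = v at h
    cases h with
    | nil h => simp at hw
    | left h => simp [hs] at h
    | right _ h1 h2 =>
      obtain ⟨rfl, h⟩ := List.append_inj' hw rfl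
      cases h
      exact ⟨_, h1, h2⟩
  · rintro ⟨t, h1, h2⟩
    exact Accepts.right hs h1 h2

/-! ### Complementation -/

/-- The automaton for the complement: `none` is the state entered when `D` has no move. -/
def compl (D : HeadDFA S A) : HeadDFA (Option S) A where
  head s := s.elim Head.left D.head
  next s a t := (∃ s' t', s = some s' ∧ t = some t' ∧ D.next s' a t') ∨
    (t = none ∧ ∀ s' t', s = some s' → ¬ D.next s' a t')
  next_unique := by
    rintro s a t t' (⟨s₁, t₁, rfl, rfl, h₁⟩ | ⟨rfl, h₁⟩) (⟨s₂, t₂, h, rfl, h₂⟩ | ⟨rfl, h₂⟩)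
    · cases h
      rw [D.next_unique h₁ h₂]
    · exact absurd h₁ (h₂ _ _ rfl)
    · exact absurd h₂ (h₁ _ _ h)
    · rfl
  start := some D.start
  accept := {s | ∀ s', s = some s' → s' ∉ D.accept}

/-- The sink has a move to itself on every letter, and it satisfies the acceptance condition
vacuously. -/
theorem compl_accepts_none (w : List A) : D.compl.Accepts none w := by
  induction w with
  | nil => exact .nil (by simp [compl])
  | cons a w ih => exact .left rfl (Or.inr ⟨rfl, by simp⟩) ih

/-- Since the state fixes the head, a word has at most one run; it fails either by ending in a
nonaccepting state or by getting stuck, and the stuck run is continued in the sink. The induction is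
on the length because letters disappear at both ends. -/
theorem compl_accepts_some : ∀ (n : ℕ) (s : S) (w : List A), w.length = n →
    (D.compl.Accepts (some s) w ↔ ¬ D.Accepts s w) := by
  intro n
  induction n with
  | zero =>
    intro s w hw
    obtain rfl := List.length_eq_zero_iff.1 hw
    simp [accepts_nil, compl]
  | succ n ih =>
    intro s w hw
    -- One move, stated without reference to the end from which `a` is taken, so that it serves both
    -- heads.
    have key : ∀ a v, v.length = n → ((∃ t, D.compl.next (some s) a t ∧ D.compl.Accepts t v) ↔
        ¬ ∃ t, D.next s a t ∧ D.Accepts t v) := by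
      intro a v hv
      by_cases h : ∃ t, D.next s a t
      · obtain ⟨t, ht⟩ := h
        constructor
        · rintro ⟨t', h1, h2⟩ ⟨t₂, h3, h4⟩
          cases D.next_unique ht h3
          cases D.compl.next_unique h1 (Or.inl ⟨s, t, rfl, rfl, ht⟩)
          exact (ih t v hv).1 h2 h4
        · intro h
          exact ⟨some t, Or.inl ⟨s, t, rfl, rfl, ht⟩,
            (ih t v hv).2 fun h' => h ⟨t, ht, h'⟩⟩
      · push Not at h
        refine iff_of_true ⟨none, Or.inr ⟨rfl, ?_⟩, compl_accepts_none v⟩ ?_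
        · rintro s' t' h'
          cases h'
          exact h t'
        · rintro ⟨t, h', -⟩
          exact h t h'
    cases hs : D.head s with
    | left =>
      cases w with
      | nil => simp at hw
      | cons a v =>
        rw [accepts_cons hs, accepts_cons (D := D.compl) (s := some s) hs]
        exact key a v (by simpa using hw)
    | right =>
      rcases List.eq_nil_or_concat w with rfl | ⟨v, a, rfl⟩
      · simp at hw
      · rw [List.concat_eq_append] at hw ⊢
        rw [accepts_concat hs, accepts_concat (D := D.compl) (s := some s) hs]
        exact key a v (by simpa using hw)

theorem mem_compl_language (w : List A) : w ∈ D.compl.language ↔ w ∉ D.language :=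
  compl_accepts_some w.length D.start w rfl

/-! ### Realization by input-driven automata -/

/-- `M` works like `D`, up to the correspondence `r` of the states and `g` of the symbols. -/
structure Realizes {Q A' G : Type} (M : IDDHPDA Q A' G) (D : HeadDFA S A) (r : Q → S → Prop)
    (g : A → A') : Prop where
  sig : ∀ a, M.sig a = Act.keep
  unique_right : ∀ {q s s'}, r q s → r q s' → s = s'
  unique_left : ∀ {q q' s}, r q s → r q' s → q = q'
  injective : Function.Injective g
  start : r M.start D.start
  accept : ∀ {q s}, r q s → (q ∈ M.accept ↔ s ∈ D.accept)
  keep : ∀ {q h a' z p}, p ∈ M.keepTrans q h a' z ↔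
    ∃ s a t, r q s ∧ r p t ∧ g a = a'.1 ∧ h = D.head s ∧ D.next s a t
  total : ∀ {q s a t}, r q s → D.next s a t → ∃ p, r p t

namespace Realizes

variable {Q A' G : Type} {M : IDDHPDA Q A' G} {r : Q → S → Prop} {g : A → A'}

/-- All symbols have the action `keep`, so the push and pop cases are void and the two remaining
ones differ only in the end of the word that is shortened. -/
theorem step_iff (R : Realizes M D r g) {h : Head} {c c' : IDDHPDA.Config Q A' G} :
    M.Step h c c' ↔ c.stack = c'.stack ∧ ∃ s a t, r c.state s ∧ r c'.state t ∧ h = D.head s ∧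
      D.next s a t ∧ ((h = Head.left ∧ c.unread = g a :: c'.unread) ∨
        (h = Head.right ∧ c.unread = c'.unread ++ [g a])) := by
  constructor
  · intro hs
    cases hs with
    | pushLeft ha => simp [R.sig] at ha
    | pushRight ha => simp [R.sig] at ha
    | popLeft ha => simp [R.sig] at ha
    | popRight ha => simp [R.sig] at ha
    | keepLeft ha h =>
      obtain ⟨s, a, t, h1, h2, rfl, h4, h5⟩ := R.keep.1 h
      exact ⟨rfl, s, a, t, h1, h2, h4, h5, Or.inl ⟨rfl, rfl⟩⟩
    | keepRight ha h =>
      obtain ⟨s, a, t, h1, h2, rfl, h4, h5⟩ := R.keep.1 h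
      exact ⟨rfl, s, a, t, h1, h2, h4, h5, Or.inr ⟨rfl, rfl⟩⟩
  · obtain ⟨q, w, st⟩ := c
    obtain ⟨q', w', st'⟩ := c'
    dsimp only
    rintro ⟨rfl, s, a, t, h1, h2, h3, h4, ⟨rfl, rfl⟩ | ⟨rfl, rfl⟩⟩
    · exact .keepLeft (R.sig _) (R.keep.2 ⟨s, a, t, h1, h2, rfl, h3, h4⟩)
    · exact .keepRight (R.sig _) (R.keep.2 ⟨s, a, t, h1, h2, rfl, h3, h4⟩)

theorem deterministic (R : Realizes M D r g) : M.Deterministic := by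
  rintro ⟨q, w, st⟩ h₁ h₂ ⟨q₁, w₁, st₁⟩ ⟨q₂, w₂, st₂⟩ H₁ H₂
  rw [R.step_iff] at H₁ H₂
  obtain ⟨e₁, s₁, a₁, t₁, r₁, r₁', k₁, n₁, u₁⟩ := H₁
  obtain ⟨e₂, s₂, a₂, t₂, r₂, r₂', k₂, n₂, u₂⟩ := H₂
  cases R.unique_right r₁ r₂
  dsimp only at *
  subst e₁ e₂
  obtain rfl : h₁ = h₂ := k₁.trans k₂.symm
  have : g a₁ = g a₂ ∧ w₁ = w₂ := by
    rcases u₁ with ⟨rfl, rfl⟩ | ⟨rfl, rfl⟩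
    · simpa using u₂
    · have : w₁ ++ [g a₁] = w₂ ++ [g a₂] := by simpa using u₂
      obtain ⟨e, e'⟩ := List.append_inj' this rfl
      exact ⟨by simpa using e', e⟩
  obtain ⟨hg, rfl⟩ := this
  cases R.injective hg
  cases D.next_unique n₁ n₂
  cases R.unique_left r₁' r₂'
  exact ⟨rfl, rfl⟩

/-- Runs are carried along `r` in both directions. Since `r` is only a partial correspondence, `D`
may have infinitely many states while `M` is finite; `total` gives a counterpart to every state that
a run enters. -/
theorem language_eq (R : Realizes M D r g) : M.language = List.map g '' D.language := by
  ext w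
  constructor
  · rintro ⟨q, hq, st, H⟩
    have key : ∀ c : IDDHPDA.Config Q A' G,
        Relation.ReflTransGen (fun c c' => ∃ h, M.Step h c c') c ⟨q, [], st⟩ →
        ∀ s, r c.state s → ∃ v, D.Accepts s v ∧ v.map g = c.unread := by
      intro c hc
      induction hc using Relation.ReflTransGen.head_induction_on with
      | refl => exact fun s hs => ⟨[], .nil ((R.accept hs).1 hq), rfl⟩
      | head h _ ih =>
        intro s hs
        obtain ⟨h, H⟩ := h
        obtain ⟨-, s', a, t, r₁, r₂, k, n, u⟩ := R.step_iff.1 H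
        cases R.unique_right r₁ hs
        obtain ⟨v, hv, e⟩ := ih t r₂
        rcases u with ⟨rfl, u⟩ | ⟨rfl, u⟩
        · exact ⟨a :: v, .left k.symm n hv, by simp [u, e]⟩
        · exact ⟨v ++ [a], .right k.symm n hv, by simp [u, e]⟩
    obtain ⟨v, hv, e⟩ := key _ H _ R.start
    exact ⟨v, hv, e⟩
  · rintro ⟨v, hv, rfl⟩
    have key : ∀ s v, D.Accepts s v → ∀ q, r q s → ∃ q' ∈ M.accept, ∃ st,
        Relation.ReflTransGen (fun c c' => ∃ h, M.Step h c c') ⟨q, v.map g, []⟩ ⟨q', [], st⟩ := by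
      intro s v h
      induction h with
      | nil h => exact fun q hq => ⟨q, (R.accept hq).2 h, [], .refl⟩
      | left h1 h2 _ ih =>
        intro q hq
        obtain ⟨p, hp⟩ := R.total hq h2
        obtain ⟨q', hq', st, H⟩ := ih p hp
        exact ⟨q', hq', st, .head (b := ⟨p, _, []⟩) ⟨_, R.step_iff.2 ⟨rfl, _, _, _, hq, hp, h1.symm, h2,
          Or.inl ⟨rfl, by simp⟩⟩⟩ H⟩
      | right h1 h2 _ ih =>
        intro q hq
        obtain ⟨p, hp⟩ := R.total hq h2
        obtain ⟨q', hq', st, H⟩ := ih p hp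
        exact ⟨q', hq', st, .head (b := ⟨p, _, []⟩) ⟨_, R.step_iff.2 ⟨rfl, _, _, _, hq, hp, h1.symm, h2,
          Or.inr ⟨rfl, by simp⟩⟩⟩ H⟩
    exact key _ _ hv _ R.start

end Realizes

theorem acceptedByDet [Finite S] (D : HeadDFA S A) : AcceptedByDet D.language := by
  let M : IDDHPDA S A Empty :=
    { sig := fun _ => Act.keep
      start := D.start
      accept := D.accept
      pushTrans := fun _ _ _ _ => ∅
      popTrans := fun _ _ _ _ => ∅
      keepTrans := fun s h a _ => {t | h = D.head s ∧ D.next s a.1 t} }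
  have R : Realizes M D Eq id :=
    { sig := fun _ => rfl
      unique_right := fun h h' => h.symm.trans h'
      unique_left := fun h h' => h.trans h'.symm
      injective := Function.injective_id
      start := rfl
      accept := by rintro q s rfl; rfl
      keep := by simp [M]
      total := fun _ _ => ⟨_, rfl⟩ }
  exact ⟨S, Empty, ‹_›, inferInstance, M, R.deterministic, by simp [R.language_eq]⟩

/-! ### Realization by finite descriptions -/

/-- The description `d` is that of `D`, the states being numbered by `f` and the symbols by `g`. -/
structure DescribedBy (D : HeadDFA S A) (d : Desc) (f : S → ℕ) (g : A → ℕ) : Prop where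
  sig : ∀ x ∈ d.sig, x = Act.keep
  injective_state : Function.Injective f
  injective_symbol : Function.Injective g
  symbol_lt : ∀ a, g a < d.sig.length
  start : f D.start = 0
  accept : ∀ s, f s ∈ d.accept ↔ s ∈ D.accept
  le_last : ∀ s a t, D.next s a t → f t ≤ d.lastState
  keep : ∀ e, e ∈ d.keepTable ↔
    ∃ s a t, D.next s a t ∧ e = (f s, D.head s, g a, none, f t)
  stack : d.stackSize = 0

namespace DescribedBy

variable {d : Desc} {f : S → ℕ} {g : A → ℕ}

theorem realizes (H : DescribedBy D d f g) :
    Realizes d.toAutomaton D (fun q s => q.val = f s) (fun a => ⟨g a, H.symbol_lt a⟩) where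
  sig a := H.sig _ (List.get_mem _ _)
  unique_right h h' := H.injective_state (h.symm.trans h')
  unique_left h h' := Fin.ext (h.trans h'.symm)
  injective a b h := H.injective_symbol (Fin.mk.inj_iff.1 h)
  start := by simp [Desc.toAutomaton, H.start]
  accept {q s} h := by rw [← H.accept, ← h]; rfl
  keep {q h a' z p} := by
    -- There are no pushdown symbols, so `⊥` is the only possible top; this is why the table lists
    -- only entries with `none`.
    have hz : z = none := by
      cases z with
      | none => rfl
      | some z => exact absurd z.2 (by simp [H.stack])
    subst hz
    refine (H.keep _).trans ?_
    simp only [Prod.mk.injEq, Option.map_none, true_and, Fin.ext_iff]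
    constructor
    · rintro ⟨s, a, t, h, h1, h2, h3, h4⟩
      exact ⟨s, a, t, h1, h4, h3.symm, h2, h⟩
    · rintro ⟨s, a, t, h1, h4, h3, h2, h⟩
      exact ⟨s, a, t, h, h1, h2, h3.symm, h4⟩
  total _ h := ⟨⟨_, Nat.lt_succ_of_le (H.le_last _ _ _ h)⟩, rfl⟩

theorem deterministic (H : DescribedBy D d f g) : d.Deterministic := H.realizes.deterministic

theorem language_eq (H : DescribedBy D d f g) : d.language = List.map g '' D.language := by
  ext w
  simp only [Desc.language, H.realizes.language_eq, Set.mem_ofPred_eq, Set.mem_image]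
  constructor
  · rintro ⟨_, ⟨v, hv, rfl⟩, rfl⟩
    exact ⟨v, hv, by simp⟩
  · rintro ⟨v, hv, rfl⟩
    exact ⟨_, ⟨v, hv, rfl⟩, by simp⟩

end DescribedBy

theorem exists_describedBy [Finite S] [Finite A] (D : HeadDFA S A) {g : A → ℕ} {k : ℕ}
    (hg : Function.Injective g) (hk : ∀ a, g a < k) : ∃ d f, DescribedBy D d f g := by
  classical
  obtain ⟨n, ⟨e⟩⟩ := Finite.exists_equiv_fin S
  -- A description has initial state `0`. The other states are shifted by one, so all numbers are at
  -- most `n`, the chosen `lastState`.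
  let f : S → ℕ := fun s => if s = D.start then 0 else e s + 1
  have hf : Function.Injective f := by
    intro s t h
    by_cases hs : s = D.start <;> by_cases ht : t = D.start <;>
      simp [f, hs, ht, ← Fin.ext_iff] at h ⊢
    exact h
  have fin : {x | ∃ s a t, D.next s a t ∧
      x = (f s, D.head s, g a, (none : Option ℕ), f t)}.Finite := by
    refine (Set.finite_range fun y : S × A × S =>
      (f y.1, D.head y.1, g y.2.1, (none : Option ℕ), f y.2.2)).subset ?_
    rintro _ ⟨s, a, t, -, rfl⟩
    exact ⟨(s, a, t), rfl⟩
  refine ⟨⟨n, 0, List.replicate k Act.keep, (Set.toFinite (f '' D.accept)).toFinset.toList, [], [],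
    fin.toFinset.toList⟩, f, ?_, hf, hg, ?_, ?_, ?_, ?_, ?_, rfl⟩
  · simp
  · simpa using hk
  · simp [f]
  · simp [hf.eq_iff]
  · intro _ _ t _
    simp only [f]
    split
    · simp
    · exact (e t).2
  · intro x
    simp

end HeadDFA

end DoubleHead

namespace DoubleHead

variable {Q T : Type}

/-! ### Rewriting systems on instantaneous descriptions -/

/-- A set of rewriting rules for IDs: `δ q x p b d` says that a head in the state `q` that scans
`x` (`none` is the end of the word) can print `b`, enter the state `p`, and move to `d`. -/
abbrev Rules (Q T : Type) := Q → Option T → Q → T → Option Dir → Prop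

/-- One rewriting step. -/
inductive Rules.Next (δ : Rules Q T) : ID Q T → ID Q T → Prop
  | right {q p : Q} {b : T} {l r : List T} : δ q r.head? p b (some .right) →
      Next δ ⟨l, q, r⟩ ⟨l ++ [b], p, r.tail⟩
  | left {q p : Q} {b c : T} {l r : List T} : δ q r.head? p b (some .left) →
      Next δ ⟨l ++ [c], q, r⟩ ⟨l, p, c :: b :: r.tail⟩
  | stay {q p : Q} {b : T} {l r : List T} : δ q r.head? p b none →
      Next δ ⟨l, q, r⟩ ⟨l, p, b :: r.tail⟩

/-! ### Checking a rewriting step letter by letter -/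

/-- The states of the device that compares two IDs letter by letter. -/
inductive SyncState (Q T : Type) where
  | copy
  | left (p : Q) (c : T)
  | left' (p q : Q)
  | right (q : Q) (b : T)
  | stay (q p : Q)
  | done

open CompSymbol in
/-- The moves of the device while both words are being read. -/
inductive SyncStep (δ : Rules Q T) :
    SyncState Q T → CompSymbol Q T → CompSymbol Q T → SyncState Q T → Prop
  | copy (a) : SyncStep δ .copy (tape a) (tape a) .copy
  -- The windows are `c q x` over `p c b` for a left move, `q x` over `b p` for a right move, and `q
  -- x` over `p b` without a move. The first pair of different letters tells which case applies.
  | left (p c) : SyncStep δ .copy (tape c) (state p) (.left p c)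
  | right (q b) : SyncStep δ .copy (state q) (tape b) (.right q b)
  | stay (q p) : SyncStep δ .copy (state q) (state p) (.stay q p)
  | left' (p q c) : SyncStep δ (.left p c) (state q) (tape c) (.left' p q)
  | doneLeft {p q x b} : δ q (some x) p b (some .left) →
      SyncStep δ (.left' p q) (tape x) (tape b) .done
  | doneRight {p q x b} : δ q (some x) p b (some .right) →
      SyncStep δ (.right q b) (tape x) (state p) .done
  | doneStay {p q x b} : δ q (some x) p b none →
      SyncStep δ (.stay q p) (tape x) (tape b) .done
  | done (a) : SyncStep δ .done (tape a) (tape a) .done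

open CompSymbol in
/-- The device accepts one more letter of the second word at the end of the first word. -/
inductive SyncExt (δ : Rules Q T) : SyncState Q T → CompSymbol Q T → Prop
  | left {p q b} : δ q none p b (some .left) → SyncExt δ (.left' p q) (tape b)
  | right {p q b} : δ q none p b (some .right) → SyncExt δ (.right q b) (state p)
  | stay {p q b} : δ q none p b none → SyncExt δ (.stay q p) (tape b)

/-- The pairs of words that the device accepts. -/
inductive SyncRun (δ : Rules Q T) :
    SyncState Q T → List (CompSymbol Q T) → List (CompSymbol Q T) → Prop
  | nil : SyncRun δ .done [] []
  | ext {s b} : SyncExt δ s b → SyncRun δ s [] [b]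
  | cons {s s' a b u v} : SyncStep δ s a b s' → SyncRun δ s' u v → SyncRun δ s (a :: u) (b :: v)

/-- The rules need not be deterministic: a new state records only letters already read, and `δ` is
merely tested on them. -/
theorem SyncStep.unique {δ : Rules Q T} {s a b t t'} (h : SyncStep δ s a b t)
    (h' : SyncStep δ s a b t') : t = t' := by
  cases h <;> cases h' <;> rfl

/-- The symbols that occur in IDs. -/
def CompSymbol.IsLetter : CompSymbol Q T → Prop
  | .tape _ => True
  | .state _ => True
  | _ => False

theorem SyncStep.isLetter {δ : Rules Q T} {s a b t} (h : SyncStep δ s a b t) :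
    a.IsLetter ∧ b.IsLetter := by
  cases h <;> exact ⟨trivial, trivial⟩

theorem SyncExt.isLetter {δ : Rules Q T} {s a} (h : SyncExt δ s a) : a.IsLetter := by
  cases h <;> trivial

theorem SyncRun.isLetter {δ : Rules Q T} {s u v} (h : SyncRun δ s u v) :
    (∀ a ∈ u, a.IsLetter) ∧ ∀ a ∈ v, a.IsLetter := by
  induction h with
  | nil => simp
  | ext h => simpa using h.isLetter
  | cons h _ ih =>
    simp only [List.forall_mem_cons]
    exact ⟨⟨h.isLetter.1, ih.1⟩, h.isLetter.2, ih.2⟩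

section SyncRun

variable {δ : Rules Q T}

theorem syncRun_done {u v : List (CompSymbol Q T)} :
    SyncRun δ .done u v ↔ ∃ r : List T, u = r.map .tape ∧ v = r.map .tape := by
  constructor
  · intro h
    generalize hs : SyncState.done = s at h
    induction h with
    | nil => exact ⟨[], rfl, rfl⟩
    | ext h => subst hs; cases h
    | cons h _ ih =>
      subst hs
      cases h with
      | done a =>
        obtain ⟨r, rfl, rfl⟩ := ih rfl
        exact ⟨a :: r, rfl, rfl⟩
  · rintro ⟨r, rfl, rfl⟩
    induction r with
    | nil => exact .nil
    | cons a r ih => exact .cons (.done a) ih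

theorem syncRun_left' {p q : Q} {u v : List (CompSymbol Q T)} :
    SyncRun δ (.left' p q) u v ↔ ∃ (r : List T) (b : T), δ q r.head? p b (some .left) ∧
      u = r.map .tape ∧ v = .tape b :: r.tail.map .tape := by
  constructor
  · intro h
    cases h with
    | ext h => cases h with
      | left h => exact ⟨[], _, h, rfl, rfl⟩
    | cons h h' => cases h with
      | doneLeft h =>
        obtain ⟨r, rfl, rfl⟩ := syncRun_done.1 h'
        exact ⟨_ :: r, _, h, rfl, rfl⟩
  · rintro ⟨r, b, h, rfl, rfl⟩
    cases r with
    | nil => exact .ext (.left h)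
    | cons x r => exact .cons (.doneLeft h) (syncRun_done.2 ⟨r, rfl, rfl⟩)

theorem syncRun_stay {p q : Q} {u v : List (CompSymbol Q T)} :
    SyncRun δ (.stay q p) u v ↔ ∃ (r : List T) (b : T), δ q r.head? p b none ∧
      u = r.map .tape ∧ v = .tape b :: r.tail.map .tape := by
  constructor
  · intro h
    cases h with
    | ext h => cases h with
      | stay h => exact ⟨[], _, h, rfl, rfl⟩
    | cons h h' => cases h with
      | doneStay h =>
        obtain ⟨r, rfl, rfl⟩ := syncRun_done.1 h'
        exact ⟨_ :: r, _, h, rfl, rfl⟩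
  · rintro ⟨r, b, h, rfl, rfl⟩
    cases r with
    | nil => exact .ext (.stay h)
    | cons x r => exact .cons (.doneStay h) (syncRun_done.2 ⟨r, rfl, rfl⟩)

theorem syncRun_right {q : Q} {b : T} {u v : List (CompSymbol Q T)} :
    SyncRun δ (.right q b) u v ↔ ∃ (r : List T) (p : Q), δ q r.head? p b (some .right) ∧
      u = r.map .tape ∧ v = .state p :: r.tail.map .tape := by
  constructor
  · intro h
    cases h with
    | ext h => cases h with
      | right h => exact ⟨[], _, h, rfl, rfl⟩
    | cons h h' => cases h with
      | doneRight h =>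
        obtain ⟨r, rfl, rfl⟩ := syncRun_done.1 h'
        exact ⟨_ :: r, _, h, rfl, rfl⟩
  · rintro ⟨r, p, h, rfl, rfl⟩
    cases r with
    | nil => exact .ext (.right h)
    | cons x r => exact .cons (.doneRight h) (syncRun_done.2 ⟨r, rfl, rfl⟩)

theorem Rules.Next.cons {c c' : ID Q T} (a : T) (h : δ.Next c c') :
    δ.Next ⟨a :: c.before, c.state, c.after⟩ ⟨a :: c'.before, c'.state, c'.after⟩ := by
  cases h with
  | right h => exact .right (l := a :: _) h
  | left h => exact .left (l := a :: _) h
  | stay h => exact .stay (l := a :: _) h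

/-- The device accepts exactly the pairs of an ID and one of its successors. -/
theorem syncRun_copy {u v : List (CompSymbol Q T)} :
    SyncRun δ .copy u v ↔ ∃ c c', δ.Next c c' ∧ c.word = u ∧ c'.word = v := by
  constructor
  · intro h
    generalize hs : SyncState.copy = s at h
    induction h with
    | nil => cases hs
    | ext h => subst hs; cases h
    | cons h h' ih =>
      subst hs
      cases h with
      | copy a =>
        obtain ⟨c, c', h, rfl, rfl⟩ := ih rfl
        exact ⟨_, _, h.cons a, rfl, rfl⟩
      | left p c =>
        cases h' with
        | ext h => cases h
        | cons h h' => cases h with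
          | left' _ q =>
            obtain ⟨r, b, h, rfl, rfl⟩ := syncRun_left'.1 h'
            exact ⟨_, _, .left (l := []) h, rfl, rfl⟩
      | right q b =>
        obtain ⟨r, p, h, rfl, rfl⟩ := syncRun_right.1 h'
        exact ⟨_, _, .right (l := []) h, rfl, rfl⟩
      | stay q p =>
        obtain ⟨r, b, h, rfl, rfl⟩ := syncRun_stay.1 h'
        exact ⟨_, _, .stay (l := []) h, rfl, rfl⟩
  -- The tape symbols before the window are the same in both words.
  · have pre : ∀ (l : List T) u v, SyncRun δ .copy u v →
        SyncRun δ .copy (l.map .tape ++ u) (l.map .tape ++ v) := by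
      intro l u v h
      induction l with
      | nil => exact h
      | cons a l ih => exact .cons (.copy a) ih
    rintro ⟨c, c', h, rfl, rfl⟩
    cases h with
    | @right q p b l r h =>
      have := pre l _ _ (.cons (.right q b) (syncRun_right.2 ⟨r, p, h, rfl, rfl⟩))
      simpa [ID.word] using this
    | @left q p b c l r h =>
      have := pre l _ _ (.cons (.left p c) (.cons (.left' p q c)
        (syncRun_left'.2 ⟨r, b, h, rfl, rfl⟩)))
      simpa [ID.word] using this
    | @stay q p b l r h =>
      have := pre l _ _ (.cons (.stay q p) (syncRun_stay.2 ⟨r, b, h, rfl, rfl⟩))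
      simpa [ID.word] using this

end SyncRun

end DoubleHead

namespace DoubleHead

variable {Q T : Type}

/-! ### Nested words -/

/-- The split point is the first entry that violates `p`. -/
theorem _root_.List.append_cons_inj_of_forall {α : Type*} {p : α → Prop} {u u' y y' : List α}
    {x x' : α} (hu : ∀ a ∈ u, p a) (hu' : ∀ a ∈ u', p a) (hx : ¬ p x) (hx' : ¬ p x')
    (h : u ++ x :: y = u' ++ x' :: y') : u = u' ∧ x = x' ∧ y = y' := by
  induction u generalizing u' with
  | nil =>
    cases u' with
    | nil => simpa using h
    | cons b u' => simp at h; exact absurd (hu' b (by simp)) (h.1 ▸ hx)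
  | cons a u ih =>
    cases u' with
    | nil => simp at h; exact absurd (hu a (by simp)) (h.1 ▸ hx')
    | cons b u' =>
      simp only [List.cons_append, List.cons.injEq] at h
      obtain ⟨rfl, h⟩ := h
      have h := ih (u' := u') (fun a ha => hu a (by simp [ha])) (fun a ha => hu' a (by simp [ha])) h
      exact ⟨by rw [h.1], h.2⟩

theorem not_isLetter_border : ¬ (CompSymbol.border : CompSymbol Q T).IsLetter := id

theorem not_isLetter_dollar : ¬ (CompSymbol.dollar : CompSymbol Q T).IsLetter := id

/-- `Nest E S u₀ w`: the word `w` has the form `u₀ # u₁ # ⋯ # uₙ $ vₙᴿ # ⋯ # v₁ᴿ # v₀ᴿ` where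
`S uᵢ vᵢ uᵢ₊₁` for `i < n` and `E uₙ vₙ`. -/
inductive Nest (E : List (CompSymbol Q T) → List (CompSymbol Q T) → Prop)
    (S : List (CompSymbol Q T) → List (CompSymbol Q T) → List (CompSymbol Q T) → Prop) :
    List (CompSymbol Q T) → List (CompSymbol Q T) → Prop
  | last {u v} : (∀ a ∈ u, a.IsLetter) → (∀ a ∈ v, a.IsLetter) → E u v →
      Nest E S u (u ++ .dollar :: v.reverse)
  | cons {u v u' w} : (∀ a ∈ u, a.IsLetter) → (∀ a ∈ v, a.IsLetter) → S u v u' →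
      Nest E S u' w → Nest E S u (u ++ .border :: (w ++ .border :: v.reverse))

section Nest

variable {E E' : List (CompSymbol Q T) → List (CompSymbol Q T) → Prop}
  {S S' : List (CompSymbol Q T) → List (CompSymbol Q T) → List (CompSymbol Q T) → Prop}
  {u u' w : List (CompSymbol Q T)}

/-- After reversal, the last separator becomes the first nonletter. -/
theorem append_border_reverse_inj {w w' v v' : List (CompSymbol Q T)}
    (hv : ∀ a ∈ v, a.IsLetter) (hv' : ∀ a ∈ v', a.IsLetter)
    (h : w ++ .border :: v.reverse = w' ++ .border :: v'.reverse) : w = w' ∧ v = v' := by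
  have h := congrArg List.reverse h
  simp only [List.reverse_append, List.reverse_cons, List.reverse_reverse, List.append_assoc,
    List.singleton_append] at h
  obtain ⟨h1, -, h2⟩ := List.append_cons_inj_of_forall hv hv' not_isLetter_border
    not_isLetter_border h
  exact ⟨List.reverse_injective h2, h1⟩

/-- Separators are not letters, so the outermost blocks of `w` are determined by `w`. Two nestings
of the same word therefore have the same blocks, and their conditions can be combined block by
block. -/
theorem Nest.inter (h : Nest E S u w) (h' : Nest E' S' u' w) :
    u = u' ∧ Nest (fun u v => E u v ∧ E' u v) (fun u v t => S u v t ∧ S' u v t) u w := by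
  induction h generalizing u' with
  | @last u v hu hv hE =>
    generalize hw : u ++ CompSymbol.dollar :: v.reverse = w at h'
    cases h' with
    | last hu' hv' hE' =>
      obtain ⟨rfl, -, h⟩ := List.append_cons_inj_of_forall hu hu' not_isLetter_dollar
        not_isLetter_dollar hw
      cases List.reverse_injective h
      exact ⟨rfl, .last hu hv ⟨hE, hE'⟩⟩
    | cons hu' hv' hS' =>
      obtain ⟨-, h, -⟩ := List.append_cons_inj_of_forall hu hu' not_isLetter_dollar
        not_isLetter_border hw
      cases h
  | @cons u v t w hu hv hS hN ih =>
    generalize hx : u ++ CompSymbol.border :: (w ++ CompSymbol.border :: v.reverse) = x at h'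
    cases h' with
    | last hu' hv' hE' =>
      obtain ⟨-, h, -⟩ := List.append_cons_inj_of_forall hu hu' not_isLetter_border
        not_isLetter_dollar hx
      cases h
    | cons hu' hv' hS' hN' =>
      obtain ⟨rfl, -, h⟩ := List.append_cons_inj_of_forall hu hu' not_isLetter_border
        not_isLetter_border hx
      obtain ⟨rfl, rfl⟩ := append_border_reverse_inj hv hv' h
      obtain ⟨rfl, h⟩ := ih hN'
      exact ⟨rfl, .cons hu hv ⟨hS, hS'⟩ h⟩

theorem Nest.mono (hE : ∀ u v, E u v → E' u v) (hS : ∀ u v t, S u v t → S' u v t)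
    (h : Nest E S u w) : Nest E' S' u w := by
  induction h with
  | last hu hv h => exact .last hu hv (hE _ _ h)
  | cons hu hv h _ ih => exact .cons hu hv (hS _ _ _ h) ih

end Nest

/-! ### The automaton that checks the steps from the left half to the right half -/

/-- The states of `leftToRight`. -/
inductive LRState (Q T : Type) where
  | source (s : SyncState Q T)
  | target (s : SyncState Q T) (a : CompSymbol Q T)
  | border (s : SyncState Q T)
  | dollar (s : SyncState Q T)

/-- The moves of `leftToRight`. -/
inductive LRStep (δ : Rules Q T) : LRState Q T → CompSymbol Q T → LRState Q T → Prop
  | source {s a} : a.IsLetter → LRStep δ (.source s) a (.target s a)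
  | target {s a b s'} : SyncStep δ s a b s' → LRStep δ (.target s a) b (.source s')
  | sourceBorder {s} : LRStep δ (.source s) .border (.border s)
  -- The right block may be one letter longer than the left one. The state `.border .done` covers
  -- both equal lengths and the situation after the extra letter.
  | extBorder {s b} : SyncExt δ s b → LRStep δ (.border s) b (.border .done)
  | border : LRStep δ (.border .done) .border (.source .copy)
  | sourceDollar {s} : LRStep δ (.source s) .dollar (.dollar s)
  | extDollar {s b} : SyncExt δ s b → LRStep δ (.dollar s) b (.dollar .done)

/-- The automaton that checks `uᵢ ⊢ vᵢ` in `u₀ # u₁ # ⋯ # uₙ $ vₙᴿ # ⋯ # v₁ᴿ # v₀ᴿ`. -/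
def leftToRight (δ : Rules Q T) : HeadDFA (LRState Q T) (CompSymbol Q T) where
  head
    | .source _ => .left
    | _ => .right
  next := LRStep δ
  next_unique := by
    intro s a t t' h h'
    cases h with
    | source h => cases h' with
      | source => rfl
      | sourceBorder => exact h.elim
      | sourceDollar => exact h.elim
    | target h => cases h' with
      | target h' => rw [h.unique h']
    | sourceBorder => cases h' with
      | source h => exact h.elim
      | sourceBorder => rfl
    | extBorder h => cases h' with
      | extBorder => rfl
      | border => cases h
    | border => cases h' with
      | extBorder h => cases h
      | border => rfl
    | sourceDollar => cases h' with
      | source h => exact h.elim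
      | sourceDollar => rfl
    | extDollar h => cases h' with
      | extDollar => rfl
  start := .source .copy
  accept := {.dollar .done}

section LeftToRight

variable {δ : Rules Q T}

/-- A round of the two heads takes one letter from each end, hence the strong induction on the
length; the separator met by the left head ends the current pair of blocks. -/
theorem leftToRight_accepts_source {s : SyncState Q T} {w : List (CompSymbol Q T)}
    (h : (leftToRight δ).Accepts (.source s) w) : ∃ u v, SyncRun δ s u v ∧
      (w = u ++ .dollar :: v.reverse ∨ ∃ w', w = u ++ .border :: (w' ++ .border :: v.reverse) ∧
        (leftToRight δ).Accepts (.source .copy) w') := by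
  generalize hn : w.length = n
  induction n using Nat.strong_induction_on generalizing s w with
  | _ n ih =>
    cases w with
    | nil => simp [HeadDFA.accepts_nil, leftToRight] at h
    | cons a w =>
      obtain ⟨t, h1, h2⟩ := (HeadDFA.accepts_cons rfl).1 h
      -- If nothing remains after the left head has moved, the letter read was `$` and the
      -- comparison was already complete.
      rcases List.eq_nil_or_concat w with rfl | ⟨w, b, rfl⟩
      · rw [HeadDFA.accepts_nil] at h2
        cases h2
        cases h1
        exact ⟨[], [], .nil, Or.inl rfl⟩
      rw [List.concat_eq_append] at *
      cases h1 with
      | source ha =>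
        obtain ⟨t, h3, h4⟩ := (HeadDFA.accepts_concat rfl).1 h2
        cases h3 with
        | target h3 =>
          obtain ⟨u, v, hr, H⟩ := ih _ (by simp at hn; omega) h4 rfl
          refine ⟨_, _, .cons h3 hr, ?_⟩
          rcases H with rfl | ⟨w', rfl, h5⟩
          · exact Or.inl (by simp)
          · exact Or.inr ⟨w', by simp, h5⟩
      | sourceBorder =>
        obtain ⟨t, h3, h4⟩ := (HeadDFA.accepts_concat rfl).1 h2
        cases h3 with
        | extBorder h3 =>
          rcases List.eq_nil_or_concat w with rfl | ⟨w, c, rfl⟩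
          · rw [HeadDFA.accepts_nil] at h4
            cases h4
          · rw [List.concat_eq_append] at *
            obtain ⟨t, h5, h6⟩ := (HeadDFA.accepts_concat rfl).1 h4
            cases h5 with
            | extBorder h => cases h
            | border => exact ⟨[], _, .ext h3, Or.inr ⟨w, by simp, h6⟩⟩
        | border => exact ⟨[], _, .nil, Or.inr ⟨w, by simp, h4⟩⟩
      | sourceDollar =>
        obtain ⟨t, h3, h4⟩ := (HeadDFA.accepts_concat rfl).1 h2
        cases h3 with
        | extDollar h3 =>
          rcases List.eq_nil_or_concat w with rfl | ⟨w, c, rfl⟩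
          · exact ⟨[], _, .ext h3, Or.inl (by simp)⟩
          · rw [List.concat_eq_append] at *
            obtain ⟨t, h5, h6⟩ := (HeadDFA.accepts_concat rfl).1 h4
            cases h5 with
            | extDollar h => cases h

theorem leftToRight_accepts_of_syncRun {s : SyncState Q T} {u v : List (CompSymbol Q T)}
    (h : SyncRun δ s u v) : (leftToRight δ).Accepts (.source s) (u ++ .dollar :: v.reverse) := by
  induction h with
  | nil => exact .left rfl .sourceDollar (.nil rfl)
  | ext h => exact .left rfl .sourceDollar (.right (w := []) rfl (.extDollar h) (.nil rfl))
  | @cons s s' a b u v h _ ih =>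
    have := HeadDFA.Accepts.left rfl (LRStep.source h.isLetter.1)
      (.right (D := leftToRight δ) rfl (.target h) ih)
    simpa using this

theorem leftToRight_accepts_of_syncRun' {s : SyncState Q T} {u v w : List (CompSymbol Q T)}
    (h : SyncRun δ s u v) (hw : (leftToRight δ).Accepts (.source .copy) w) :
    (leftToRight δ).Accepts (.source s) (u ++ .border :: (w ++ .border :: v.reverse)) := by
  induction h with
  | nil => exact .left rfl .sourceBorder (.right rfl .border hw)
  | @ext s b h =>
    have := HeadDFA.Accepts.left rfl LRStep.sourceBorder
      (.right (D := leftToRight δ) rfl (.extBorder h) (.right (D := leftToRight δ) rfl .border hw))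
    simpa using this
  | @cons s s' a b u v h _ ih =>
    have := HeadDFA.Accepts.left rfl (LRStep.source h.isLetter.1)
      (.right (D := leftToRight δ) rfl (.target h) ih)
    simpa using this

theorem mem_leftToRight_language {w : List (CompSymbol Q T)} : w ∈ (leftToRight δ).language ↔
    ∃ u, Nest (SyncRun δ .copy) (fun u v _ => SyncRun δ .copy u v) u w := by
  constructor
  · intro h
    change (leftToRight δ).Accepts (.source .copy) w at h
    generalize hn : w.length = n
    induction n using Nat.strong_induction_on generalizing w with
    | _ n ih =>
      obtain ⟨u, v, hr, rfl | ⟨w', rfl, h'⟩⟩ := leftToRight_accepts_source h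
      · exact ⟨u, .last hr.isLetter.1 hr.isLetter.2 hr⟩
      · obtain ⟨u', H⟩ := ih _ (by simp at hn; omega) h' rfl
        exact ⟨u, .cons hr.isLetter.1 hr.isLetter.2 hr H⟩
  · rintro ⟨u, h⟩
    induction h with
    | last _ _ h => exact leftToRight_accepts_of_syncRun h
    | cons _ _ h _ ih => exact leftToRight_accepts_of_syncRun' h ih

end LeftToRight

/-! ### The automaton that checks the steps from the right half to the left half -/

/-- The states of `rightToLeft` after the first ID has been read. -/
inductive RLState (Q T : Type) where
  | source (s : SyncState Q T)
  | target (s : SyncState Q T) (a : CompSymbol Q T)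
  | border (s : SyncState Q T)
  | last

/-- The tape symbols and the states in `F`. -/
def CompSymbol.IsFinal (F : Set Q) : CompSymbol Q T → Prop
  | .tape _ => True
  | .state q => q ∈ F
  | _ => False

theorem CompSymbol.IsFinal.isLetter {F : Set Q} {a : CompSymbol Q T} (h : a.IsFinal F) :
    a.IsLetter := by
  cases a <;> trivial

/-- The moves of `rightToLeft`. -/
inductive RLStep {P : Type} (δ : Rules Q T) (I : HeadDFA P (CompSymbol Q T)) (F : Set Q) :
    P ⊕ RLState Q T → CompSymbol Q T → P ⊕ RLState Q T → Prop
  -- The guard keeps the moves of `I` apart from those on separators, so determinism is preserved.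
  | init {p a p'} : a.IsLetter → I.next p a p' → RLStep δ I F (.inl p) a (.inl p')
  | initBorder {p} : p ∈ I.accept → RLStep δ I F (.inl p) .border (.inr (.source .copy))
  | initDollar {p} : p ∈ I.accept → RLStep δ I F (.inl p) .dollar (.inr .last)
  | source {s a} : a.IsLetter → RLStep δ I F (.inr (.source s)) a (.inr (.target s a))
  | target {s a b s'} : SyncStep δ s a b s' →
      RLStep δ I F (.inr (.target s a)) b (.inr (.source s'))
  | sourceBorder {s} : RLStep δ I F (.inr (.source s)) .border (.inr (.border s))
  | ext {s b} : SyncExt δ s b → RLStep δ I F (.inr (.border s)) b (.inr (.border .done))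
  | border : RLStep δ I F (.inr (.border .done)) .border (.inr (.source .copy))
  | dollar : RLStep δ I F (.inr (.border .done)) .dollar (.inr .last)
  -- Only the reversed `vₙ` is left. That it is an ID is not checked here; `leftToRight` does that.
  | last {a} : a.IsFinal F → RLStep δ I F (.inr .last) a (.inr .last)

/-- The automaton that checks, in `u₀ # u₁ # ⋯ # uₙ $ vₙᴿ # ⋯ # v₁ᴿ # v₀ᴿ`, that `u₀` is accepted
by `I`, that `vᵢ ⊢ uᵢ₊₁`, and that the states in `vₙ` are in `F`. -/
def rightToLeft {P : Type} (δ : Rules Q T) (I : HeadDFA P (CompSymbol Q T)) (F : Set Q) :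
    HeadDFA (P ⊕ RLState Q T) (CompSymbol Q T) where
  head
    | .inr (.source _) => .right
    | _ => .left
  next := RLStep δ I F
  next_unique := by
    intro s a t t' h h'
    cases h with
    | init h h₁ => cases h' with
      | init _ h₂ => rw [I.next_unique h₁ h₂]
      | initBorder => exact h.elim
      | initDollar => exact h.elim
    | initBorder => cases h' with
      | init h => exact h.elim
      | initBorder => rfl
    | initDollar => cases h' with
      | init h => exact h.elim
      | initDollar => rfl
    | source h => cases h' with
      | source => rfl
      | sourceBorder => exact h.elim
    | target h => cases h' with
      | target h' => rw [h.unique h']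
    | sourceBorder => cases h' with
      | source h => exact h.elim
      | sourceBorder => rfl
    | ext h => cases h' with
      | ext => rfl
      | border => cases h
      | dollar => cases h
    | border => cases h' with
      | ext h => cases h
      | border => rfl
    | dollar => cases h' with
      | ext h => cases h
      | dollar => rfl
    | last h => cases h' with
      | last => rfl
  start := .inl I.start
  accept := {.inr .last}

section RightToLeft

variable {P : Type} {δ : Rules Q T} {I : HeadDFA P (CompSymbol Q T)} {F : Set Q}

/-- The words that are accepted after the separator `x` has been read by the left head. -/
def rightToLeftRest (δ : Rules Q T) (I : HeadDFA P (CompSymbol Q T)) (F : Set Q)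
    (x : CompSymbol Q T) (w : List (CompSymbol Q T)) : Prop :=
  x = .border ∧ (rightToLeft δ I F).Accepts (.inr (.source .copy)) w ∨
    x = .dollar ∧ (rightToLeft δ I F).Accepts (.inr .last) w

/-- In this phase only the left head moves, so `I` is simulated faithfully if it is an ordinary
one-way automaton. -/
theorem rightToLeft_accepts_init (hI : ∀ p, I.head p = .left) {p : P}
    {w : List (CompSymbol Q T)} : (rightToLeft δ I F).Accepts (.inl p) w ↔
      ∃ u x w', (∀ a ∈ u, a.IsLetter) ∧ I.Accepts p u ∧ w = u ++ x :: w' ∧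
        rightToLeftRest δ I F x w' := by
  constructor
  · intro h
    induction w generalizing p with
    | nil => simp [HeadDFA.accepts_nil, rightToLeft] at h
    | cons a w ih =>
      obtain ⟨t, h1, h2⟩ := (HeadDFA.accepts_cons rfl).1 h
      cases h1 with
      | init ha h3 =>
        obtain ⟨u, x, w', hu, h4, rfl, h5⟩ := ih h2
        exact ⟨a :: u, x, w', by simpa using ⟨ha, hu⟩, .left (hI _) h3 h4, rfl, h5⟩
      | initBorder h3 => exact ⟨[], _, w, by simp, .nil h3, rfl, Or.inl ⟨rfl, h2⟩⟩
      | initDollar h3 => exact ⟨[], _, w, by simp, .nil h3, rfl, Or.inr ⟨rfl, h2⟩⟩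
  · rintro ⟨u, x, w', hu, h, rfl, h'⟩
    induction u generalizing p with
    | nil =>
      rw [HeadDFA.accepts_nil] at h
      rcases h' with ⟨rfl, h'⟩ | ⟨rfl, h'⟩
      · exact .left rfl (.initBorder h) h'
      · exact .left rfl (.initDollar h) h'
    | cons a u ih =>
      obtain ⟨t, h1, h2⟩ := (HeadDFA.accepts_cons (hI _)).1 h
      exact .left rfl (.init (hu a (by simp)) h1) (ih (fun b hb => hu b (by simp [hb])) h2)

theorem rightToLeft_accepts_last {w : List (CompSymbol Q T)} :
    (rightToLeft δ I F).Accepts (.inr .last) w ↔ ∀ a ∈ w, a.IsFinal F := by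
  induction w with
  | nil => simp [HeadDFA.accepts_nil, rightToLeft]
  | cons a w ih =>
    rw [HeadDFA.accepts_cons rfl, List.forall_mem_cons, ← ih]
    constructor
    · rintro ⟨t, h1, h2⟩
      cases h1 with
      | last h => exact ⟨h, h2⟩
    · rintro ⟨h1, h2⟩
      exact ⟨_, .last h1, h2⟩

theorem rightToLeft_accepts_done {w : List (CompSymbol Q T)}
    (h : (rightToLeft δ I F).Accepts (.inr (.border .done)) w) :
    ∃ x w', w = x :: w' ∧ rightToLeftRest δ I F x w' := by
  cases w with
  | nil => simp [HeadDFA.accepts_nil, rightToLeft] at h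
  | cons a w =>
    obtain ⟨t, h1, h2⟩ := (HeadDFA.accepts_cons rfl).1 h
    cases h1 with
    | ext h => cases h
    | border => exact ⟨_, _, rfl, Or.inl ⟨rfl, h2⟩⟩
    | dollar => exact ⟨_, _, rfl, Or.inr ⟨rfl, h2⟩⟩

/-- The mirror image of `leftToRight_accepts_source`: the right head leads through `vᵢ` and the left
head follows through `uᵢ₊₁`. The separator after `uᵢ₊₁` then tells whether `vᵢ₊₁` is the last block.
-/
theorem rightToLeft_accepts_source {s : SyncState Q T} {w : List (CompSymbol Q T)}
    (h : (rightToLeft δ I F).Accepts (.inr (.source s)) w) : ∃ v u x w', SyncRun δ s v u ∧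
      w = u ++ x :: (w' ++ .border :: v.reverse) ∧ rightToLeftRest δ I F x w' := by
  generalize hn : w.length = n
  induction n using Nat.strong_induction_on generalizing s w with
  | _ n ih =>
    rcases List.eq_nil_or_concat w with rfl | ⟨w, a, rfl⟩
    · simp [HeadDFA.accepts_nil, rightToLeft] at h
    rw [List.concat_eq_append] at *
    obtain ⟨t, h1, h2⟩ := (HeadDFA.accepts_concat rfl).1 h
    cases h1 with
    | source ha =>
      cases w with
      | nil => simp [HeadDFA.accepts_nil, rightToLeft] at h2
      | cons b w =>
        obtain ⟨t, h3, h4⟩ := (HeadDFA.accepts_cons rfl).1 h2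
        cases h3 with
        | target h3 =>
          obtain ⟨v, u, x, w', hr, rfl, h5⟩ := ih _ (by simp at hn; omega) h4 rfl
          exact ⟨_, _, x, w', .cons h3 hr, by simp, h5⟩
    | sourceBorder =>
      cases w with
      | nil => simp [HeadDFA.accepts_nil, rightToLeft] at h2
      | cons b w =>
        obtain ⟨t, h3, h4⟩ := (HeadDFA.accepts_cons rfl).1 h2
        cases h3 with
        | ext h3 =>
          obtain ⟨x, w', rfl, h5⟩ := rightToLeft_accepts_done h4
          exact ⟨[], _, x, w', .ext h3, by simp, h5⟩
        | border => exact ⟨[], [], _, _, .nil, by simp, Or.inl ⟨rfl, h4⟩⟩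
        | dollar => exact ⟨[], [], _, _, .nil, by simp, Or.inr ⟨rfl, h4⟩⟩

theorem rightToLeft_accepts_of_rest {x : CompSymbol Q T} {w : List (CompSymbol Q T)}
    (h : rightToLeftRest δ I F x w) :
    (rightToLeft δ I F).Accepts (.inr (.border .done)) (x :: w) := by
  rcases h with ⟨rfl, h⟩ | ⟨rfl, h⟩
  · exact .left rfl .border h
  · exact .left rfl .dollar h

theorem rightToLeft_accepts_of_syncRun {s : SyncState Q T} {u v w : List (CompSymbol Q T)}
    {x : CompSymbol Q T} (h : SyncRun δ s v u) (hw : rightToLeftRest δ I F x w) :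
    (rightToLeft δ I F).Accepts (.inr (.source s))
      (u ++ x :: (w ++ .border :: v.reverse)) := by
  induction h with
  | nil =>
    have := HeadDFA.Accepts.right (D := rightToLeft δ I F) rfl .sourceBorder (rightToLeft_accepts_of_rest hw)
    simpa using this
  | @ext s b h =>
    have := HeadDFA.Accepts.right (D := rightToLeft δ I F) rfl .sourceBorder
      (.left (D := rightToLeft δ I F) rfl (.ext h) (rightToLeft_accepts_of_rest hw))
    simpa using this
  | @cons s s' a b v u h _ ih =>
    have := HeadDFA.Accepts.right rfl (RLStep.source h.isLetter.1)
      (.left (D := rightToLeft δ I F) rfl (.target h) ih)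
    simpa using this

theorem nest_of_rightToLeftRest {x : CompSymbol Q T} {u w : List (CompSymbol Q T)}
    (hu : ∀ a ∈ u, a.IsLetter) (h : rightToLeftRest δ I F x w) :
    Nest (fun _ v => ∀ a ∈ v, a.IsFinal F) (fun _ v t => SyncRun δ .copy v t) u
      (u ++ x :: w) := by
  generalize hn : w.length = n
  induction n using Nat.strong_induction_on generalizing u x w with
  | _ n ih =>
    rcases h with ⟨rfl, h⟩ | ⟨rfl, h⟩
    · obtain ⟨v, u', x, w', hr, rfl, hw'⟩ := rightToLeft_accepts_source h
      have := Nest.cons hu hr.isLetter.1 hr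
        (ih w'.length (by simp at hn; omega) hr.isLetter.2 hw' rfl)
      simpa using this
    · rw [rightToLeft_accepts_last] at h
      have : Nest (fun _ v => ∀ a ∈ v, a.IsFinal F) (fun _ v t => SyncRun δ .copy v t) u
          (u ++ .dollar :: w.reverse.reverse) :=
        .last hu (fun a ha => (h a (by simpa using ha)).isLetter) (fun a ha => h a (by simpa using ha))
      simpa using this

theorem rightToLeftRest_of_nest {u w : List (CompSymbol Q T)}
    (h : Nest (fun _ v => ∀ a ∈ v, a.IsFinal F) (fun _ v t => SyncRun δ .copy v t) u w) :
    (∀ a ∈ u, a.IsLetter) ∧ ∃ x w', w = u ++ x :: w' ∧ rightToLeftRest δ I F x w' := by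
  induction h with
  | last hu _ h =>
    exact ⟨hu, _, _, rfl, Or.inr ⟨rfl, rightToLeft_accepts_last.2 (by simpa using h)⟩⟩
  | cons hu _ h _ ih =>
    obtain ⟨-, x, w', rfl, h'⟩ := ih
    refine ⟨hu, _, _, rfl, Or.inl ⟨rfl, ?_⟩⟩
    have := rightToLeft_accepts_of_syncRun h h'
    simpa using this

theorem mem_rightToLeft_language (hI : ∀ p, I.head p = .left) {w : List (CompSymbol Q T)} :
    w ∈ (rightToLeft δ I F).language ↔ ∃ u ∈ I.language,
      Nest (fun _ v => ∀ a ∈ v, a.IsFinal F) (fun _ v t => SyncRun δ .copy v t) u w := by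
  refine (rightToLeft_accepts_init hI).trans ⟨?_, ?_⟩
  · rintro ⟨u, x, w', hu, h, rfl, h'⟩
    exact ⟨u, h, nest_of_rightToLeftRest hu h'⟩
  · rintro ⟨u, h, h'⟩
    obtain ⟨hu, x, w', rfl, h⟩ := rightToLeftRest_of_nest (I := I) h'
    exact ⟨u, x, w', hu, ‹_›, rfl, h⟩

theorem leftToRight_inter_rightToLeft (hI : ∀ p, I.head p = .left) :
    (leftToRight δ).language ∩ (rightToLeft δ I F).language = {w | ∃ u ∈ I.language,
      Nest (fun u v => SyncRun δ .copy u v ∧ ∀ a ∈ v, a.IsFinal F)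
        (fun u v t => SyncRun δ .copy u v ∧ SyncRun δ .copy v t) u w} := by
  ext w
  rw [Set.mem_inter_iff, mem_leftToRight_language, mem_rightToLeft_language hI]
  constructor
  · rintro ⟨⟨u, h⟩, u', hu, h'⟩
    obtain ⟨rfl, h⟩ := h.inter h'
    exact ⟨u, hu, h⟩
  · rintro ⟨u, hu, h⟩
    exact ⟨⟨u, h.mono (fun _ _ h => h.1) fun _ _ _ h => h.1⟩,
      u, hu, h.mono (fun _ _ h => h.2) fun _ _ _ h => h.2⟩

end RightToLeft

/-! ### Finiteness -/

instance [Finite Q] [Finite T] : Finite (CompSymbol Q T) :=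
  Finite.of_surjective (α := T ⊕ Q ⊕ Bool)
    (Sum.elim .tape (Sum.elim .state fun b => bif b then .border else .dollar)) fun
    | .tape a => ⟨.inl a, rfl⟩
    | .state q => ⟨.inr (.inl q), rfl⟩
    | .border => ⟨.inr (.inr true), rfl⟩
    | .dollar => ⟨.inr (.inr false), rfl⟩

instance [Finite Q] [Finite T] : Finite (SyncState Q T) :=
  Finite.of_surjective (α := Bool ⊕ (Q × T) ⊕ (Q × Q) ⊕ (Q × T) ⊕ (Q × Q))
    (Sum.elim (fun b => bif b then .copy else .done) (Sum.elim (fun x => .left x.1 x.2)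
      (Sum.elim (fun x => .left' x.1 x.2) (Sum.elim (fun x => .right x.1 x.2)
        fun x => .stay x.1 x.2)))) fun
    | .copy => ⟨.inl true, rfl⟩
    | .done => ⟨.inl false, rfl⟩
    | .left p c => ⟨.inr (.inl (p, c)), rfl⟩
    | .left' p q => ⟨.inr (.inr (.inl (p, q))), rfl⟩
    | .right q b => ⟨.inr (.inr (.inr (.inl (q, b)))), rfl⟩
    | .stay q p => ⟨.inr (.inr (.inr (.inr (q, p)))), rfl⟩

instance [Finite Q] [Finite T] : Finite (LRState Q T) :=
  Finite.of_surjective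
    (α := SyncState Q T ⊕ (SyncState Q T × CompSymbol Q T) ⊕ SyncState Q T ⊕ SyncState Q T)
    (Sum.elim .source (Sum.elim (fun x => .target x.1 x.2) (Sum.elim .border .dollar))) fun
    | .source s => ⟨.inl s, rfl⟩
    | .target s a => ⟨.inr (.inl (s, a)), rfl⟩
    | .border s => ⟨.inr (.inr (.inl s)), rfl⟩
    | .dollar s => ⟨.inr (.inr (.inr s)), rfl⟩

instance [Finite Q] [Finite T] : Finite (RLState Q T) :=
  Finite.of_surjective
    (α := SyncState Q T ⊕ (SyncState Q T × CompSymbol Q T) ⊕ SyncState Q T ⊕ Unit)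
    (Sum.elim .source (Sum.elim (fun x => .target x.1 x.2) (Sum.elim .border fun _ => .last))) fun
    | .source s => ⟨.inl s, rfl⟩
    | .target s a => ⟨.inr (.inl (s, a)), rfl⟩
    | .border s => ⟨.inr (.inr (.inl s)), rfl⟩
    | .last => ⟨.inr (.inr (.inr ())), rfl⟩

end DoubleHead

namespace DoubleHead

variable {Q T : Type}

/-! ### Valid computations -/

theorem ID.isLetter_of_mem_word (c : ID Q T) : ∀ a ∈ c.word, a.IsLetter := by
  simp only [ID.word, List.mem_append, List.mem_map, List.mem_cons]
  rintro a (⟨x, -, rfl⟩ | rfl | ⟨x, -, rfl⟩) <;> trivial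

/-- The state is the only letter that is not a tape symbol, so it marks the split. -/
theorem ID.word_injective : Function.Injective (ID.word : ID Q T → List (CompSymbol Q T)) := by
  rintro ⟨l, q, r⟩ ⟨l', q', r'⟩ h
  have ht : Function.Injective (CompSymbol.tape : T → CompSymbol Q T) := fun _ _ h => by
    cases h; rfl
  obtain ⟨h1, h2, h3⟩ := List.append_cons_inj_of_forall
    (p := fun a : CompSymbol Q T => ∃ x, a = .tape x) (by simp) (by simp) (by simp) (by simp) h
  cases h2
  cases List.map_injective_iff.2 ht h1
  cases List.map_injective_iff.2 ht h3
  rfl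

theorem ID.isFinal_word {F : Set Q} (c : ID Q T) :
    (∀ a ∈ c.word, a.IsFinal F) ↔ c.state ∈ F := by
  simp only [ID.word, List.mem_append, List.mem_map, List.mem_cons]
  constructor
  · exact fun h => h (.state c.state) (by simp)
  · rintro h a (⟨x, -, rfl⟩ | rfl | ⟨x, -, rfl⟩)
    · trivial
    · exact h
    · trivial

theorem _root_.List.intercalate_append_singleton {α : Type*} (s a : List α) {l : List (List α)}
    (hl : l ≠ []) : s.intercalate (l ++ [a]) = s.intercalate l ++ (s ++ a) := by
  induction l with
  | nil => exact absurd rfl hl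
  | cons b l ih =>
    cases l with
    | nil => simp [List.intercalate, List.intersperse]
    | cons c l => simpa [List.intercalate, List.intersperse] using ih (by simp)

/-- The word `w₀ # w₂ # ⋯ # w₂ₙ $ w₂ₙ₊₁ᴿ # ⋯ # w₃ᴿ # w₁ᴿ`. -/
def interleavedWord (w : ℕ → ID Q T) (n : ℕ) : List (CompSymbol Q T) :=
  [CompSymbol.border].intercalate ((List.range (n + 1)).map fun i => (w (2 * i)).word) ++
    CompSymbol.dollar :: [CompSymbol.border].intercalate
      ((List.range (n + 1)).reverse.map fun i => (w (2 * i + 1)).word.reverse)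

theorem interleavedWord_zero (w : ℕ → ID Q T) :
    interleavedWord w 0 = (w 0).word ++ .dollar :: (w 1).word.reverse := by
  simp [interleavedWord, List.intercalate]

/-- The outermost blocks come from `w 0` and `w 1`; the inside belongs to the sequence shifted by
two. -/
theorem interleavedWord_succ (w : ℕ → ID Q T) (n : ℕ) :
    interleavedWord w (n + 1) = (w 0).word ++ .border ::
      (interleavedWord (fun i => w (i + 2)) n ++ .border :: (w 1).word.reverse) := by
  have h1 : (List.range (n + 1 + 1)).map (fun i => (w (2 * i)).word) =
      (w 0).word :: (List.range (n + 1)).map fun i => (w (2 * i + 2)).word := by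
    rw [List.range_succ_eq_map, List.map_cons, List.map_map]
    rfl
  have h2 : (List.range (n + 1 + 1)).reverse.map (fun i => (w (2 * i + 1)).word.reverse) =
      ((List.range (n + 1)).reverse.map fun i => (w (2 * i + 1 + 2)).word.reverse) ++
        [(w 1).word.reverse] := by
    rw [List.range_succ_eq_map, List.reverse_cons, List.map_append, ← List.map_reverse,
      List.map_map]
    rfl
  unfold interleavedWord
  rw [h1, h2, List.intercalate_append_singleton _ _ (by simp)]
  have h3 : ∀ (a : List (CompSymbol Q T)) (l : List (List (CompSymbol Q T))), l ≠ [] →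
      [CompSymbol.border].intercalate (a :: l) =
        a ++ .border :: [CompSymbol.border].intercalate l := by
    intro a l hl
    cases l with
    | nil => exact absurd rfl hl
    | cons b l => simp [List.intercalate, List.intersperse]
  rw [h3 _ _ (by simp)]
  simp

theorem nest_iff_interleavedWord {δ : Rules Q T} {F : Set Q} {u x : List (CompSymbol Q T)} :
    Nest (fun u v => SyncRun δ .copy u v ∧ ∀ a ∈ v, a.IsFinal F)
        (fun u v t => SyncRun δ .copy u v ∧ SyncRun δ .copy v t) u x ↔
      ∃ (n : ℕ) (w : ℕ → ID Q T), (w 0).word = u ∧ (w (2 * n + 1)).state ∈ F ∧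
        (∀ i ≤ 2 * n, δ.Next (w i) (w (i + 1))) ∧ x = interleavedWord w n := by
  constructor
  · intro h
    induction h with
    | last _ _ h =>
      obtain ⟨h, hF⟩ := h
      obtain ⟨c, c', hc, rfl, rfl⟩ := syncRun_copy.1 h
      refine ⟨0, fun i => if i = 0 then c else c', rfl, c'.isFinal_word.1 hF, ?_, ?_⟩
      · intro i hi
        obtain rfl : i = 0 := by omega
        exact hc
      · rw [interleavedWord_zero]; rfl
    | cons _ _ h _ ih =>
      obtain ⟨n, w, h0, hF, hn, rfl⟩ := ih
      obtain ⟨h1, h2⟩ := h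
      obtain ⟨a, b, hab, rfl, rfl⟩ := syncRun_copy.1 h1
      obtain ⟨b', c, hbc, hb, rfl⟩ := syncRun_copy.1 h2
      -- The steps were checked separately on words; injectivity identifies the target of one step
      -- with the source of the next.
      cases ID.word_injective hb
      cases ID.word_injective h0
      refine ⟨n + 1, fun | 0 => a | 1 => b | i + 2 => w i, rfl, hF, ?_, ?_⟩
      · rintro (_ | _ | i) hi
        · exact hab
        · exact hbc
        · exact hn i (by omega)
      · rw [interleavedWord_succ]
  · rintro ⟨n, w, rfl, hF, hn, rfl⟩
    induction n generalizing w with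
    | zero =>
      rw [interleavedWord_zero]
      exact .last (ID.isLetter_of_mem_word _) (ID.isLetter_of_mem_word _)
        ⟨syncRun_copy.2 ⟨_, _, hn 0 le_rfl, rfl, rfl⟩, (ID.isFinal_word _).2 hF⟩
    | succ n ih =>
      rw [interleavedWord_succ]
      exact .cons (ID.isLetter_of_mem_word _) (ID.isLetter_of_mem_word _)
        ⟨syncRun_copy.2 ⟨_, _, hn 0 (by omega), rfl, rfl⟩,
          syncRun_copy.2 ⟨_, _, hn 1 (by omega), rfl, rfl⟩⟩
        (ih (fun i => w (i + 2)) hF fun i hi => hn (i + 2) (by omega))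

/-- A nested word encodes an odd number of steps. The loop at `c'` repairs the parity. -/
theorem nest_of_reflTransGen {δ : Rules Q T} {F : Set Q} {c c' : ID Q T}
    (h : Relation.ReflTransGen δ.Next c c') (hF : c'.state ∈ F) (hc' : δ.Next c' c') :
    ∃ x, Nest (fun u v => SyncRun δ .copy u v ∧ ∀ a ∈ v, a.IsFinal F)
        (fun u v t => SyncRun δ .copy u v ∧ SyncRun δ .copy v t) c.word x := by
  have base : ∃ x, Nest (fun u v => SyncRun δ .copy u v ∧ ∀ a ∈ v, a.IsFinal F)
      (fun u v t => SyncRun δ .copy u v ∧ SyncRun δ .copy v t) c'.word x :=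
    ⟨_, .last c'.isLetter_of_mem_word c'.isLetter_of_mem_word
      ⟨syncRun_copy.2 ⟨_, _, hc', rfl, rfl⟩, c'.isFinal_word.2 hF⟩⟩
  -- `Nest.cons` consumes two steps while the induction prepends one, so the claim is carried for
  -- `c` together with some successor `d`.
  suffices (∃ x, Nest (fun u v => SyncRun δ .copy u v ∧ ∀ a ∈ v, a.IsFinal F)
        (fun u v t => SyncRun δ .copy u v ∧ SyncRun δ .copy v t) c.word x) ∧
      ∃ d, δ.Next c d ∧ ∃ x, Nest (fun u v => SyncRun δ .copy u v ∧ ∀ a ∈ v, a.IsFinal F)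
        (fun u v t => SyncRun δ .copy u v ∧ SyncRun δ .copy v t) d.word x from this.1
  induction h using Relation.ReflTransGen.head_induction_on with
  | refl => exact ⟨base, c', hc', base⟩
  | @head a b h _ ih =>
    obtain ⟨h1, d, hd, x, h2⟩ := ih
    exact ⟨⟨_, .cons a.isLetter_of_mem_word b.isLetter_of_mem_word
      ⟨syncRun_copy.2 ⟨_, _, h, rfl, rfl⟩, syncRun_copy.2 ⟨_, _, hd, rfl, rfl⟩⟩ h2⟩, b, h, h1⟩

theorem reflTransGen_of_nest {δ : Rules Q T} {F : Set Q} {c : ID Q T}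
    {x : List (CompSymbol Q T)}
    (h : Nest (fun u v => SyncRun δ .copy u v ∧ ∀ a ∈ v, a.IsFinal F)
        (fun u v t => SyncRun δ .copy u v ∧ SyncRun δ .copy v t) c.word x) :
    ∃ c', Relation.ReflTransGen δ.Next c c' ∧ c'.state ∈ F := by
  obtain ⟨n, w, h0, hF, hn, -⟩ := nest_iff_interleavedWord.1 h
  cases ID.word_injective h0
  have key : ∀ i ≤ 2 * n + 1, Relation.ReflTransGen δ.Next (w 0) (w i) := by
    intro i hi
    induction i with
    | zero => exact .refl
    | succ i ih => exact (ih (by omega)).tail (hn i (by omega))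
  exact ⟨_, key _ le_rfl, hF⟩

namespace TM

/-- The moves of a Turing machine as rewriting rules. -/
def rules (M : TM Q T) : Rules Q T := fun q x p b d =>
  ∃ d', d = some d' ∧ M.trans q (x.getD M.blank) = some (p, b, d')

theorem rules_next (M : TM Q T) {c c' : ID Q T} : M.rules.Next c c' ↔ M.Next c c' := by
  constructor
  · intro h
    cases h with
    | right h =>
      obtain ⟨d, hd, h⟩ := h
      cases hd
      exact .moveRight (by rwa [List.headD_eq_head?_getD])
    | left h =>
      obtain ⟨d, hd, h⟩ := h
      cases hd
      exact .moveLeft (by rwa [List.headD_eq_head?_getD])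
    | stay h => obtain ⟨d, hd, -⟩ := h; cases hd
  · intro h
    cases h with
    | moveRight h => exact .right ⟨_, rfl, by rwa [← List.headD_eq_head?_getD]⟩
    | moveLeft h => exact .left ⟨_, rfl, by rwa [← List.headD_eq_head?_getD]⟩

/-- The moves of `initialDFA`. -/
inductive InitialStep (M : TM Q T) : Bool → CompSymbol Q T → Bool → Prop
  | state : InitialStep M false (.state M.start) true
  | tape {a} : a ∈ M.input → InitialStep M true (.tape a) true

/-- The automaton for the set of initial IDs. -/
def initialDFA (M : TM Q T) : HeadDFA Bool (CompSymbol Q T) where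
  head _ := .left
  next := M.InitialStep
  next_unique := by
    intro s a t t' h h'
    cases h <;> cases h' <;> rfl
  start := false
  accept := {true}

theorem mem_initialDFA_language (M : TM Q T) {u : List (CompSymbol Q T)} :
    u ∈ M.initialDFA.language ↔ ∃ c, M.IsInitial c ∧ c.word = u := by
  have key : ∀ u : List (CompSymbol Q T), M.initialDFA.Accepts true u ↔
      ∃ r : List T, (∀ a ∈ r, a ∈ M.input) ∧ u = r.map .tape := by
    intro u
    constructor
    · intro h
      induction u with
      | nil => exact ⟨[], by simp⟩
      | cons a u ih =>
        obtain ⟨t, h1, h2⟩ := (HeadDFA.accepts_cons rfl).1 h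
        cases h1 with
        | @tape a ha =>
          obtain ⟨r, hr, rfl⟩ := ih h2
          exact ⟨a :: r, by simpa using ⟨ha, hr⟩, rfl⟩
    · rintro ⟨r, hr, rfl⟩
      induction r with
      | nil => exact .nil rfl
      | cons a r ih =>
        exact .left rfl (.tape (hr a (by simp))) (ih fun b hb => hr b (by simp [hb]))
  constructor
  · intro h
    cases u with
    | nil => exact absurd (HeadDFA.accepts_nil.1 h) (by simp [initialDFA])
    | cons a u =>
      obtain ⟨t, h1, h2⟩ := (HeadDFA.accepts_cons rfl).1 h
      cases h1 with
      | state =>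
        obtain ⟨r, hr, rfl⟩ := (key u).1 h2
        exact ⟨⟨[], M.start, r⟩, ⟨rfl, rfl, hr⟩, rfl⟩
  · rintro ⟨⟨l, q, r⟩, ⟨rfl, rfl, hr⟩, rfl⟩
    exact .left rfl .state ((key _).2 ⟨r, hr, rfl⟩)

theorem validComputations_eq_inter (M : TM Q T) : M.validComputations =
    (leftToRight M.rules).language ∩ (rightToLeft M.rules M.initialDFA M.final).language := by
  rw [leftToRight_inter_rightToLeft fun _ => rfl]
  ext v
  constructor
  · rintro ⟨n, w, h0, hF, hn, rfl⟩
    exact ⟨_, M.mem_initialDFA_language.2 ⟨_, h0, rfl⟩,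
      nest_iff_interleavedWord.2 ⟨n, w, rfl, hF, fun i hi => M.rules_next.2 (hn i hi), rfl⟩⟩
  · rintro ⟨u, hu, h⟩
    obtain ⟨n, w, rfl, hF, hn, rfl⟩ := nest_iff_interleavedWord.1 h
    obtain ⟨c, hc, h⟩ := M.mem_initialDFA_language.1 hu
    cases ID.word_injective h
    exact ⟨n, w, hc, hF, fun i hi => M.rules_next.1 (hn i hi), rfl⟩

theorem exists_acceptedByDet [Finite Q] [Finite T] (M : TM Q T) :
    ∃ L₁ L₂ : Set (List (CompSymbol Q T)),
      AcceptedByDet L₁ ∧ AcceptedByDet L₂ ∧ M.validComputations = L₁ ∩ L₂ :=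
  ⟨_, _, HeadDFA.acceptedByDet _, HeadDFA.acceptedByDet _, M.validComputations_eq_inter⟩

end TM

end DoubleHead

namespace DoubleHead

open Turing (TM0.Machine TM0.Supports ListBlank Tape)

/-! ### Turing machines on two-way infinite tapes as rewriting systems -/

variable {Γ Λ : Type} [Inhabited Λ]

/-- The moves of the machine `M` with states in `S` as rewriting rules.  The state `none` is entered
when `M` halts, and is never left. -/
inductive PostRule (M : TM0.Machine Γ Λ) (S : Set Λ) : Rules (Option S) Γ
  -- Every rule scans an actual symbol, so the rewriting is stuck at the right end of the word;
  -- blanks are available only as padding.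
  | right {q p : S} {y} : M q y = some (↑p, .move .right) →
      PostRule M S (some q) (some y) (some p) y (some .right)
  | left {q p : S} {y} : M q y = some (↑p, .move .left) →
      PostRule M S (some q) (some y) (some p) y (some .left)
  | write {q p : S} {y b} : M q y = some (↑p, .write b) →
      PostRule M S (some q) (some y) (some p) b none
  | halt {q : S} {y} : M q y = none → PostRule M S (some q) (some y) none y none
  | idle {y} : PostRule M S none (some y) none y none

section PostRule

variable [Inhabited Γ] {M : TM0.Machine Γ Λ} {S : Set Λ}

/-- A halting run visits finitely many cells, so some `N` bounds the room it needs on either side.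
The bound is found by induction from the halting configuration backwards. -/
theorem postRule_exists_reflTransGen (hS : TM0.Supports M S) {x : Turing.TM0.Cfg Γ Λ}
    (h : (StateTransition.eval (Turing.TM0.step M) x).Dom) : ∃ N, ∀ (q : S) (l r : List Γ),
      x = ⟨q, Tape.mk' (ListBlank.mk l.reverse) (ListBlank.mk r)⟩ → N ≤ l.length → N ≤ r.length →
      ∃ c, Relation.ReflTransGen (Rules.Next (PostRule M S)) ⟨l, some q, r⟩ c ∧ c.state = none ∧
        Rules.Next (PostRule M S) c c := by
  obtain ⟨z, H⟩ := Part.dom_iff_mem.1 h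
  obtain ⟨hr, hz⟩ := StateTransition.mem_eval.1 H
  clear H
  induction hr using Relation.ReflTransGen.head_induction_on with
  | refl =>
    refine ⟨1, ?_⟩
    rintro q l (_ | ⟨y, r⟩) rfl - hr
    · simp at hr
    · have : M q y = none := by simpa [Turing.TM0.step] using hz
      exact ⟨⟨l, none, y :: r⟩, .single (.stay (r := y :: r) (.halt this)), rfl,
        .stay (r := y :: r) .idle⟩
  | @head x x' hx _ ih =>
    obtain ⟨N, ih⟩ := ih (by
      rw [← StateTransition.reaches_eval (Relation.ReflTransGen.single hx)]; exact h)
    -- A step uses up at most one cell on either side, so two further cells are more than enough.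
    refine ⟨N + 2, ?_⟩
    rintro q l (_ | ⟨y, r⟩) rfl hl hr
    · simp at hr
    · simp only [Turing.TM0.step, Option.mem_def, Option.map_eq_some_iff] at hx
      obtain ⟨⟨p, s⟩, hM, rfl⟩ := hx
      simp only [Turing.Tape.mk'_head, Turing.ListBlank.head_mk, List.headI_cons] at hM
      obtain ⟨p, rfl⟩ : ∃ p' : S, ↑p' = p := ⟨⟨p, hS.2 hM q.2⟩, rfl⟩
      simp only [List.length_cons] at hr
      cases s with
      | move d =>
        cases d with
        | left =>
          rcases List.eq_nil_or_concat l with rfl | ⟨l, a, rfl⟩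
          · simp at hl
          · rw [List.concat_eq_append] at *
            obtain ⟨c, h1, h2⟩ := ih p l (a :: y :: r) (by simp) (by simp at hl; omega)
              (by simp; omega)
            exact ⟨c, .head (.left (r := y :: r) (.left hM)) h1, h2⟩
        | right =>
          obtain ⟨c, h1, h2⟩ := ih p (l ++ [y]) r (by simp) (by simp; omega) (by omega)
          exact ⟨c, .head (.right (r := y :: r) (.right hM)) h1, h2⟩
      | write b =>
        obtain ⟨c, h1, h2⟩ := ih p l (b :: r)
          (by simp [← Turing.ListBlank.cons_mk]) (by omega) (by simp; omega)
        exact ⟨c, .head (.stay (r := y :: r) (.write hM)) h1, h2⟩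

/-- No padding is assumed here: each rewriting step is a step of `M`, until the state `none` is
entered, which certifies that `M` has halted. -/
theorem postRule_dom_of_reflTransGen {c c' : ID (Option S) Γ}
    (h : Relation.ReflTransGen (Rules.Next (PostRule M S)) c c') (hc' : c'.state = none) {q : S}
    (hc : c.state = some q) : (StateTransition.eval (Turing.TM0.step M)
      ⟨q, Tape.mk' (ListBlank.mk c.before.reverse) (ListBlank.mk c.after)⟩).Dom := by
  induction h using Relation.ReflTransGen.head_induction_on generalizing q with
  | refl => simp [hc] at hc'
  | head h _ ih =>
    have step : ∀ (x y : Turing.TM0.Cfg Γ Λ), Turing.TM0.step M x = some y →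
        (StateTransition.eval (Turing.TM0.step M) y).Dom →
        (StateTransition.eval (Turing.TM0.step M) x).Dom := by
      intro x y hxy hy
      rwa [StateTransition.reaches_eval (Relation.ReflTransGen.single hxy)]
    cases h with
    | @right q' p b l r h =>
      cases hc
      generalize hx : r.head? = x at h
      generalize hd : some Dir.right = d at h
      cases h <;> cases hd
      rename_i p h
      obtain ⟨r, rfl⟩ : ∃ r', r = b :: r' := by cases r <;> simp_all
      refine step _ _ ?_ (ih rfl)
      simp [Turing.TM0.step, h]
    | @left q' p b a l r h =>
      cases hc
      generalize hx : r.head? = x at h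
      generalize hd : some Dir.left = d at h
      cases h <;> cases hd
      rename_i p h
      obtain ⟨r, rfl⟩ : ∃ r', r = b :: r' := by cases r <;> simp_all
      refine step _ _ ?_ (ih rfl)
      simp [Turing.TM0.step, h]
    | @stay q' p b l r h =>
      cases hc
      generalize hx : r.head? = x at h
      generalize hd : (none : Option Dir) = d at h
      cases h with
      | right => cases hd
      | left => cases hd
      | @write _ p y b h =>
        obtain ⟨r, rfl⟩ : ∃ r', r = y :: r' := by cases r <;> simp_all
        refine step _ _ ?_ (ih rfl)
        simp [Turing.TM0.step, h, ← Turing.ListBlank.cons_mk]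
      | @halt _ y h =>
        obtain ⟨r, rfl⟩ : ∃ r', r = b :: r' := by cases r <;> simp_all
        exact Part.dom_iff_mem.2 ⟨_, StateTransition.mem_eval.2
          ⟨.refl, by simp [Turing.TM0.step, h]⟩⟩

theorem _root_.Turing.ListBlank.mk_append_replicate (l : List Γ) (n : ℕ) :
    ListBlank.mk (l ++ List.replicate n default) = ListBlank.mk l :=
  (Quotient.sound' (Or.inl ⟨n, rfl⟩)).symm

/-- The machine halts on `w` if and only if there is a valid computation that starts with `w` and
sufficiently many blanks on both sides. -/
theorem exists_nest_iff_eval_dom (hS : TM0.Supports M S) (w : List Γ) :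
    (∃ i j x, Nest (fun u v => SyncRun (PostRule M S) .copy u v ∧ ∀ a ∈ v, a.IsFinal {none})
      (fun u v t => SyncRun (PostRule M S) .copy u v ∧ SyncRun (PostRule M S) .copy v t)
      (ID.word ⟨List.replicate i default, some ⟨default, hS.1⟩, w ++ List.replicate j default⟩) x) ↔
    (Turing.TM0.eval M w).Dom := by
  -- Half-tapes are words up to blanks at the far end, so every padding represents the same initial
  -- configuration.
  have init : ∀ i j, (⟨default, Tape.mk' (ListBlank.mk (List.replicate i default).reverse)
      (ListBlank.mk (w ++ List.replicate j default))⟩ : Turing.TM0.Cfg Γ Λ) =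
      Turing.TM0.init w := by
    intro i j
    rw [List.reverse_replicate, Turing.ListBlank.mk_append_replicate,
      ← List.nil_append (List.replicate i _), Turing.ListBlank.mk_append_replicate]
    rfl
  change _ ↔ (StateTransition.eval (Turing.TM0.step M) (Turing.TM0.init w)).Dom
  constructor
  · rintro ⟨i, j, x, h⟩
    obtain ⟨c', h, hc'⟩ := reflTransGen_of_nest h
    rw [← init i j]
    exact postRule_dom_of_reflTransGen h hc' rfl
  · intro h
    obtain ⟨N, H⟩ := postRule_exists_reflTransGen hS h
    obtain ⟨c, h1, h2, h3⟩ := H ⟨default, hS.1⟩ (List.replicate N default)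
      (w ++ List.replicate N default) (init N N).symm (by simp) (by simp)
    exact ⟨N, N, nest_of_reflTransGen h1 h2 h3⟩

end PostRule

end DoubleHead

namespace DoubleHead

open Turing

/-! ### An undecidable halting problem -/

/-- Numbers are written in binary, least significant digit first. Powers of two give words so
regular that a counter can generate them, which is why instances are encoded as `2 ^ m`. -/
theorem trNat_two_pow (m : ℕ) :
    PartrecToTM2.trNat (2 ^ m) = List.replicate m .bit0 ++ [.bit1] := by
  have key : ∀ m : ℕ, ∃ p : PosNum, ((2 ^ m : ℕ) : Num) = .pos p ∧
      PartrecToTM2.trPosNum p = List.replicate m .bit0 ++ [.bit1] := by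
    intro m
    induction m with
    | zero => exact ⟨1, by simp; rfl, rfl⟩
    | succ m ih =>
      obtain ⟨p, hp, h⟩ := ih
      refine ⟨p.bit0, ?_, by simp [PartrecToTM2.trPosNum, h, List.replicate_succ]⟩
      rw [pow_succ, mul_two, Nat.cast_add, hp]
      exact congrArg Num.pos p.bit0_of_bit0
  obtain ⟨p, hp, h⟩ := key m
  rw [PartrecToTM2.trNat, hp]
  exact h

/-- There is a set of natural numbers whose complement is not semidecidable, but which is
the set of all `m` such that a certain program halts on `2 ^ m`. -/
theorem exists_code_not_re : ∃ c : ToPartrec.Code,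
    ¬ REPred fun m : ℕ => ¬ (c.eval [2 ^ m]).Dom := by
  let f : ℕ →. ℕ := fun n => Nat.Partrec.Code.eval (Denumerable.ofNat _ n) 0
  have hf : Partrec f :=
    Nat.Partrec.Code.eval_part.comp (Computable.ofNat _) (Computable.const 0)
  -- Unbounded search recovers `m` from `2 ^ m`; the values at other numbers play no role.
  let g : ℕ →. ℕ := fun n => (Nat.rfind fun m => Part.some (decide (2 ^ m = n))).bind f
  have hpow : Primrec fun m : ℕ => 2 ^ m :=
    (Primrec.nat_rec₁ 1 (Primrec.nat_mul.comp (Primrec.snd) (Primrec.const 2)).to₂).of_eq fun m => by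
      induction m with
      | zero => rfl
      | succ m ih => simp only [pow_succ, ← ih]
  have hg : Partrec g := by
    refine Partrec.bind (Partrec.rfind ?_) (hf.comp Computable.snd).to₂
    have : PrimrecPred fun p : ℕ × ℕ => 2 ^ p.2 = p.1 :=
      Primrec.eq.comp (hpow.comp Primrec.snd) Primrec.fst
    exact (this.decide.to_comp.partrec).to₂
  obtain ⟨c, hc⟩ := ToPartrec.Code.exists_code (Nat.Partrec'.part_iff₁.2 hg)
  refine ⟨c, fun h => ComputablePred.halting_problem_not_re 0 ?_⟩
  have key : ∀ m : ℕ, (c.eval [2 ^ m]).Dom ↔ (f m).Dom := by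
    intro m
    have h1 := hc ⟨[2 ^ m], rfl⟩
    have h2 : (Nat.rfind fun k => Part.some (decide (2 ^ k = 2 ^ m))) = Part.some m := by
      refine Part.eq_some_iff.2 (Nat.mem_rfind.2 ⟨by simp, fun {k} hk => ?_⟩)
      simpa using hk.ne
    change c.eval [2 ^ m] = _ at h1
    rw [h1]
    change (g (2 ^ m)).Dom ↔ _
    simp only [g, h2]
    rw [Part.bind_some]
  have h' : REPred fun a : Nat.Partrec.Code => ¬ (c.eval [2 ^ Encodable.encode a]).Dom :=
    Partrec.comp h Computable.encode
  exact h'.of_eq fun a => by rw [key]; simp [f]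

/-- A finite machine on a two-way infinite tape with an undecidable halting problem for inputs of the
form `a b cᵐ`. -/
theorem exists_machine_not_re : ∃ (Γ Λ : Type) (_ : Inhabited Γ) (_ : Finite Γ) (_ : Inhabited Λ)
    (M : TM0.Machine Γ Λ) (S : Set Λ) (_ : S.Finite) (a b c : Γ), TM0.Supports M S ∧
      ¬ REPred fun m : ℕ => ¬ (TM0.eval M (a :: b :: List.replicate m c)).Dom := by
  obtain ⟨p, hp⟩ := exists_code_not_re
  -- The default label is the initial state, so this instance makes the universal transition table
  -- start with the program `p`.
  let _ : Inhabited PartrecToTM2.Λ' := ⟨PartrecToTM2.trNormal p .halt⟩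
  have s2 : TM2.Supports PartrecToTM2.tr (PartrecToTM2.codeSupp p .halt) :=
    PartrecToTM2.tr_supports p .halt
  have s0 := TM1to0.tr_supports _ (TM2to1.tr_supports _ s2)
  -- A cell holding `k` on the main stack and nothing on the others; `t` marks the bottom of the
  -- stacks.
  let x (t : Bool) (k : PartrecToTM2.Γ') : TM2to1.Γ' PartrecToTM2.K' fun _ => PartrecToTM2.Γ' :=
    (t, Function.update (fun _ => none) .main (some k))
  have : Finite PartrecToTM2.K' := Finite.of_surjective (α := Fin 4) ![.main, .rev, .aux, .stack]
    fun k => by cases k; exacts [⟨0, rfl⟩, ⟨1, rfl⟩, ⟨2, rfl⟩, ⟨3, rfl⟩]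
  refine ⟨TM2to1.Γ' PartrecToTM2.K' fun _ => PartrecToTM2.Γ', _, inferInstance,
    inferInstanceAs (Finite (Bool × (PartrecToTM2.K' → Option PartrecToTM2.Γ'))), _, _, _,
    Finset.finite_toSet _, x true .cons, x false .bit1, x false .bit0, s0, ?_⟩
  have key : ∀ m : ℕ, (p.eval [2 ^ m]).Dom ↔ (TM0.eval (TM1to0.tr (TM2to1.tr PartrecToTM2.tr))
      (x true .cons :: x false .bit1 :: List.replicate m (x false .bit0))).Dom := by
    intro m
    have h : TM2to1.trInit (K := PartrecToTM2.K') (Γ := fun _ => PartrecToTM2.Γ') .main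
        (PartrecToTM2.trList [2 ^ m]) =
        x true .cons :: x false .bit1 :: List.replicate m (x false .bit0) := by
      have h : (PartrecToTM2.trList [2 ^ m]).reverse = .cons :: .bit1 :: List.replicate m .bit0 := by
        simp [trNat_two_pow]
      rw [TM2to1.trInit, h]
      exact congrArg (fun l => x true .cons :: x false .bit1 :: l) List.map_replicate
    have h' : TM2.init (Γ := fun _ => PartrecToTM2.Γ') PartrecToTM2.K'.main
        (PartrecToTM2.trList [2 ^ m]) = PartrecToTM2.init p [2 ^ m] := by
      simp only [TM2.init, PartrecToTM2.init]
      congr 1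
      funext k
      cases k <;> rfl
    rw [← h, TM1to0.tr_eval]
    refine Iff.trans ?_ (TM2to1.tr_eval_dom PartrecToTM2.tr .main _).symm
    change _ ↔ (StateTransition.eval (TM2.step PartrecToTM2.tr) (TM2.init _ _)).Dom
    exact Iff.of_eq (congrArg Part.Dom ((congrArg (StateTransition.eval _) h').trans
      (PartrecToTM2.tr_eval p _))).symm
  simpa only [key] using hp

end DoubleHead

namespace DoubleHead

/-! ### The reduction -/

/-- The states of `paddedDFA`. -/
inductive PadState where
  | pad
  | state
  | first
  -- All `i` are allowed so that the type does not depend on `m`; a run uses only `i ≤ m`.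
  | count (i : ℕ)

variable {Q T : Type}

/-- The moves of `paddedDFA`. -/
inductive PadStep (blank : T) (q : Q) (a b c : T) (m : ℕ) :
    PadState → CompSymbol Q T → PadState → Prop
  | pad : PadStep blank q a b c m .pad (.tape blank) .pad
  | state : PadStep blank q a b c m .pad (.state q) .state
  | first : PadStep blank q a b c m .state (.tape a) .first
  | second : PadStep blank q a b c m .first (.tape b) (.count m)
  | count {i} : i < m → PadStep blank q a b c m (.count (i + 1)) (.tape c) (.count i)
  | padEnd : PadStep blank q a b c m (.count 0) (.tape blank) (.count 0)

/-- The automaton for the IDs `t q a b cᵐ t'` where `t` and `t'` consist of blanks. -/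
def paddedDFA (blank : T) (q : Q) (a b c : T) (m : ℕ) : HeadDFA PadState (CompSymbol Q T) where
  head _ := .left
  next := PadStep blank q a b c m
  next_unique := by
    intro s x t t' h h'
    cases h <;> cases h' <;> rfl
  start := .pad
  accept := {.count 0}

theorem mem_paddedDFA_language {blank : T} {q : Q} {a b c : T} {m : ℕ}
    {u : List (CompSymbol Q T)} : u ∈ (paddedDFA blank q a b c m).language ↔
      ∃ i j, u = ID.word ⟨List.replicate i blank, q,
        a :: b :: List.replicate m c ++ List.replicate j blank⟩ := by
  have padEnd : ∀ u, (paddedDFA blank q a b c m).Accepts (.count 0) u ↔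
      ∃ j, u = List.replicate j (.tape blank) := by
    intro u
    induction u with
    | nil => simp [HeadDFA.accepts_nil, paddedDFA]
    | cons x u ih =>
      rw [HeadDFA.accepts_cons rfl]
      constructor
      · rintro ⟨t, h1, h2⟩
        cases h1 with
        | padEnd =>
          obtain ⟨j, rfl⟩ := ih.1 h2
          exact ⟨j + 1, rfl⟩
      · rintro ⟨_ | j, h⟩
        · simp at h
        · cases h
          exact ⟨_, .padEnd, ih.2 ⟨j, rfl⟩⟩
  have count : ∀ i ≤ m, ∀ u, (paddedDFA blank q a b c m).Accepts (.count i) u ↔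
      ∃ j, u = List.replicate i (.tape c) ++ List.replicate j (.tape blank) := by
    intro i
    induction i with
    | zero => simpa using padEnd
    | succ i ih =>
      intro hi u
      cases u with
      | nil => simp [HeadDFA.accepts_nil, paddedDFA, List.replicate_succ]
      | cons x u =>
        rw [HeadDFA.accepts_cons rfl]
        constructor
        · rintro ⟨t, h1, h2⟩
          cases h1 with
          | count =>
            obtain ⟨j, rfl⟩ := (ih (by omega) _).1 h2
            exact ⟨j, rfl⟩
        · rintro ⟨j, h⟩
          cases h
          exact ⟨_, .count (by omega), (ih (by omega) _).2 ⟨j, rfl⟩⟩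
  have pad : ∀ u, (paddedDFA blank q a b c m).Accepts .pad u ↔
      ∃ i j, u = List.replicate i (.tape blank) ++ .state q :: .tape a :: .tape b ::
        (List.replicate m (.tape c) ++ List.replicate j (.tape blank)) := by
    intro u
    constructor
    · intro h
      induction u with
      | nil => simp [HeadDFA.accepts_nil, paddedDFA] at h
      | cons x u ih =>
        obtain ⟨t, h1, h2⟩ := (HeadDFA.accepts_cons rfl).1 h
        cases h1 with
        | pad =>
          obtain ⟨i, j, rfl⟩ := ih h2
          exact ⟨i + 1, j, rfl⟩
        | state =>
          cases u with
          | nil => simp [HeadDFA.accepts_nil, paddedDFA] at h2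
          | cons x u =>
            obtain ⟨t, h1, h2⟩ := (HeadDFA.accepts_cons rfl).1 h2
            cases h1 with
            | first =>
              cases u with
              | nil => simp [HeadDFA.accepts_nil, paddedDFA] at h2
              | cons x u =>
                obtain ⟨t, h1, h2⟩ := (HeadDFA.accepts_cons rfl).1 h2
                cases h1 with
                | second =>
                  obtain ⟨j, rfl⟩ := (count m le_rfl _).1 h2
                  exact ⟨0, j, rfl⟩
    · rintro ⟨i, j, rfl⟩
      induction i with
      | zero =>
        exact .left rfl .state (.left rfl .first (.left rfl .second
          ((count m le_rfl _).2 ⟨j, rfl⟩)))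
      | succ i ih => exact .left rfl .pad ih
  refine (pad u).trans ?_
  simp [ID.word]

/-- The numbers of the states of `paddedDFA`. -/
def PadState.code : PadState → ℕ
  | .pad => 0
  | .state => 1
  | .first => 2
  | .count i => i + 3

theorem PadState.code_injective : Function.Injective PadState.code := by
  intro s t h
  cases s <;> cases t <;> simp_all [PadState.code]

/-- The automata `rightToLeft` for the languages of `paddedDFA` have descriptions that are computable
from the number `m`. -/
theorem exists_describedBy_padded [Finite Q] [Finite T] (δ : Rules Q T) (F : Set Q) (blank : T)
    (q : Q) (a b c : T) {g : CompSymbol Q T → ℕ} {k : ℕ} (hg : Function.Injective g)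
    (hk : ∀ a, g a < k) : ∃ (d : ℕ → Desc) (f : PadState ⊕ RLState Q T → ℕ), Computable d ∧
      ∀ m, (rightToLeft δ (paddedDFA blank q a b c m) F).DescribedBy (d m) f g := by
  classical
  obtain ⟨n, ⟨e⟩⟩ := Finite.exists_equiv_fin (RLState Q T)
  let D := fun m => rightToLeft δ (paddedDFA blank q a b c m) F
  -- Even numbers for the unbounded family and odd ones for the rest make the numbering independent
  -- of `m`; the initial state `.pad` gets `0`.
  let f : PadState ⊕ RLState Q T → ℕ := Sum.elim (fun s => 2 * s.code) fun s => 2 * e s + 1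
  have hf : Function.Injective f := by
    rintro (s | s) (t | t) h <;> simp only [f, Sum.elim_inl, Sum.elim_inr] at h
    · rw [PadState.code_injective (by omega : s.code = t.code)]
    · omega
    · omega
    · rw [e.injective (Fin.ext (by omega : (e s : ℕ) = e t))]
  let R : Set (PadState ⊕ RLState Q T) :=
    {.inl .pad, .inl .state, .inl .first, .inl (.count 0)} ∪ Set.range .inr
  have hR : R.Finite := Set.Finite.union (by simp) (Set.finite_range _)
  let entry : (PadState ⊕ RLState Q T) × CompSymbol Q T × (PadState ⊕ RLState Q T) →
      ℕ × Head × ℕ × Option ℕ × ℕ := fun y => (f y.1, (D 0).head y.1, g y.2.1, none, f y.2.2)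
  -- The moves common to all `m` form a finite table. The countdown is excluded because it has no
  -- moves for `m = 0`.
  have fin : {x | ∃ s a t, (∀ m, (D m).next s a t) ∧ x = entry (s, a, t)}.Finite := by
    refine ((hR.prod (Set.finite_univ.prod hR)).image entry).subset ?_
    rintro _ ⟨s, a, t, h, rfl⟩
    refine ⟨(s, a, t), ?_, rfl⟩
    replace h := h 0
    cases h with
    | init _ h' =>
      cases h' with
      | count h => omega
      | _ => simp [R]
    | initBorder h' => cases h'; simp [R]
    | initDollar h' => cases h'; simp [R]
    | _ => simp [R]
  have next_iff : ∀ m s x t, (D m).next s x t ↔ (∀ m, (D m).next s x t) ∨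
      (s = .inl .first ∧ x = .tape b ∧ t = .inl (.count m)) ∨
      ∃ i < m, s = .inl (.count (i + 1)) ∧ x = .tape c ∧ t = .inl (.count i) := by
    intro m s x t
    constructor
    · intro h
      cases h with
      | init hx h =>
        cases h with
        | pad => exact Or.inl fun _ => .init hx .pad
        | state => exact Or.inl fun _ => .init hx .state
        | first => exact Or.inl fun _ => .init hx .first
        | second => simp
        | count h => exact Or.inr (Or.inr ⟨_, h, rfl, rfl, rfl⟩)
        | padEnd => exact Or.inl fun _ => .init hx .padEnd
      | initBorder h => exact Or.inl fun _ => .initBorder h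
      | initDollar h => exact Or.inl fun _ => .initDollar h
      | source h => exact Or.inl fun _ => .source h
      | target h => exact Or.inl fun _ => .target h
      | sourceBorder => exact Or.inl fun _ => .sourceBorder
      | ext h => exact Or.inl fun _ => .ext h
      | border => exact Or.inl fun _ => .border
      | dollar => exact Or.inl fun _ => .dollar
      | last h => exact Or.inl fun _ => .last h
    · rintro (h | ⟨rfl, rfl, rfl⟩ | ⟨i, h, rfl, rfl, rfl⟩)
      · exact h m
      · exact .init trivial .second
      · exact .init trivial (.count h)
  let d : ℕ → Desc := fun m =>
    -- This bounds both `2 * (m + 3)`, the number of `.count m`, and the odd numbers, which are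
    -- below `2 * n`.
    { lastState := 2 * m + (2 * n + 6)
      stackSize := 0
      sig := List.replicate k Act.keep
      accept := [f (.inr .last)]
      pushTable := []
      popTable := []
      keepTable := fin.toFinset.toList ++
        (4, Head.left, g (.tape b), none, 2 * (m + 3)) ::
          (List.range m).map fun i => (2 * (i + 4), Head.left, g (.tape c), none, 2 * (i + 3)) }
  refine ⟨d, f, ?_, fun m => ⟨by simp [d], hf, hg, by simpa [d] using hk, rfl, ?_, ?_, ?_, rfl⟩⟩
  · have lin : ∀ j : ℕ, Primrec fun i : ℕ => 2 * (i + j) := fun j =>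
      Primrec.nat_mul.comp (Primrec.const 2) (Primrec.nat_add.comp Primrec.id (Primrec.const j))
    have h1 : Primrec fun m : ℕ => 2 * m + (2 * n + 6) :=
      Primrec.nat_add.comp (lin 0) (Primrec.const _)
    have h2 : Primrec fun m : ℕ => (List.range m).map fun i =>
        (2 * (i + 4), Head.left, g (.tape c), (none : Option ℕ), 2 * (i + 3)) :=
      Primrec.list_map Primrec.list_range (Primrec.pair ((lin 4).comp Primrec.snd)
        (Primrec.pair (Primrec.const _) (Primrec.pair (Primrec.const _)
          (Primrec.pair (Primrec.const _) ((lin 3).comp Primrec.snd))))).to₂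
    -- The part of the table obtained by choice is a constant list, so it does not affect
    -- computability.
    have h3 : Primrec fun m : ℕ => (d m).keepTable :=
      Primrec.list_append.comp (Primrec.const _) (Primrec.list_cons.comp
        (Primrec.pair (Primrec.const _) (Primrec.pair (Primrec.const _)
          (Primrec.pair (Primrec.const _) (Primrec.pair (Primrec.const _) (lin 3))))) h2)
    have h4 : Primrec fun m : ℕ => Desc.equivProd (d m) :=
      Primrec.pair h1 (Primrec.pair (Primrec.const _) (Primrec.pair (Primrec.const _)
        (Primrec.pair (Primrec.const _) (Primrec.pair (Primrec.const _)
          (Primrec.pair (Primrec.const _) h3)))))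
    exact ((Primrec.of_equiv_symm (e := Desc.equivProd)).comp h4).to_comp
  · intro s
    simp [d, hf.eq_iff, rightToLeft]
  · intro s x t h
    rcases t with t | t
    · rcases (next_iff _ _ _ _).1 h with h | ⟨rfl, rfl, ht⟩ | ⟨i, hi, rfl, rfl, ht⟩
      · replace h := h 0
        cases h with
        | init _ h' => cases h' <;> simp [f, d, PadState.code] <;> omega
      · cases ht
        simp [f, d, PadState.code]
        omega
      · cases ht
        simp [f, d, PadState.code]
        omega
    · have := (e t).2
      simp only [f, d, Sum.elim_inr]
      omega
  · intro x
    simp only [d, List.mem_append, List.mem_cons, List.mem_map, List.mem_range,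
      Finset.mem_toList, Set.Finite.mem_toFinset, Set.mem_ofPred_eq]
    constructor
    · rintro (⟨s, y, t, h, rfl⟩ | rfl | ⟨i, hi, rfl⟩)
      · exact ⟨s, y, t, h m, rfl⟩
      · exact ⟨_, _, _, (next_iff m _ _ _).2 (Or.inr (Or.inl ⟨rfl, rfl, rfl⟩)), rfl⟩
      · exact ⟨_, _, _, (next_iff m _ _ _).2 (Or.inr (Or.inr ⟨i, hi, rfl, rfl, rfl⟩)), rfl⟩
    · rintro ⟨s, y, t, h, rfl⟩
      rcases (next_iff _ _ _ _).1 h with h | ⟨rfl, rfl, rfl⟩ | ⟨i, hi, rfl, rfl, rfl⟩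
      · exact Or.inl ⟨s, y, t, h, rfl⟩
      · exact Or.inr (Or.inl rfl)
      · exact Or.inr (Or.inr ⟨i, hi, rfl⟩)

/-- There are a fixed automaton, an automaton for the complement of its language, and a computable
family of automata such that the disjointness of the languages is not semidecidable. -/
theorem exists_reduction : ∃ (d₁ d₁' : Desc) (d₂ : ℕ → Desc), d₁.Deterministic ∧
    d₁'.Deterministic ∧ (∀ m, (d₂ m).Deterministic) ∧ Computable d₂ ∧
    (∀ m, (d₂ m).language ⊆ d₁'.language ↔ d₁.language ∩ (d₂ m).language = ∅) ∧
    ¬ REPred fun m => d₁.language ∩ (d₂ m).language = ∅ := by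
  obtain ⟨Γ, Λ, _, _, _, M, S, hSfin, a, b, c, hS, hM⟩ := exists_machine_not_re
  have : Finite S := hSfin
  obtain ⟨k, ⟨g⟩⟩ := Finite.exists_equiv_fin (CompSymbol (Option S) Γ)
  have hg : Function.Injective fun x => (g x : ℕ) := Fin.val_injective.comp g.injective
  let δ := PostRule M S
  let D₂ := fun m =>
    rightToLeft δ (paddedDFA (default : Γ) (some (⟨default, hS.1⟩ : S)) a b c m) {none}
  obtain ⟨d₁, f₁, h₁⟩ := (leftToRight δ).exists_describedBy hg fun x => (g x).2
  obtain ⟨d₁', f₁', h₁'⟩ := (leftToRight δ).compl.exists_describedBy hg fun x => (g x).2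
  obtain ⟨d₂, f₂, hd₂, h₂⟩ := exists_describedBy_padded δ {none} (default : Γ)
    (some (⟨default, hS.1⟩ : S)) a b c hg fun x => (g x).2
  have hinj := List.map_injective_iff.2 hg
  have disj : ∀ m, d₁.language ∩ (d₂ m).language = ∅ ↔
      ∀ w, ¬ (w ∈ (leftToRight δ).language ∧ w ∈ (D₂ m).language) := by
    intro m
    rw [h₁.language_eq, (h₂ m).language_eq, ← Set.image_inter hinj, Set.image_eq_empty,
      Set.eq_empty_iff_forall_notMem]
    rfl
  refine ⟨d₁, d₁', d₂, h₁.deterministic, h₁'.deterministic, fun m => (h₂ m).deterministic, hd₂,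
    fun m => ?_, fun h => hM (h.of_eq fun m => ?_)⟩
  -- The language of `d₁'` is a complement only among words over the encoded alphabet; this is
  -- enough because the language of `d₂ m` consists of such words too.
  · rw [disj, h₁'.language_eq, (h₂ m).language_eq, Set.image_subset_image_iff hinj]
    exact forall_congr' fun w => by
      rw [HeadDFA.mem_compl_language]
      tauto
  · rw [disj, ← exists_nest_iff_eval_dom hS, ← not_exists, not_iff_not]
    have key := leftToRight_inter_rightToLeft (δ := δ) (F := {none})
      (I := paddedDFA (default : Γ) (some (⟨default, hS.1⟩ : S)) a b c m) fun _ => rfl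
    constructor
    · rintro ⟨w, hw⟩
      obtain ⟨u, hu, h⟩ := key.subset hw
      obtain ⟨i, j, rfl⟩ := mem_paddedDFA_language.1 hu
      exact ⟨i, j, w, h⟩
    · rintro ⟨i, j, w, h⟩
      exact ⟨w, key.superset ⟨_, mem_paddedDFA_language.2 ⟨i, j, rfl⟩, h⟩⟩

end DoubleHead

/-! ### Transfer of undecidability to pairs of descriptions -/

theorem mainTheorem6 :
    (¬ DoubleHead.Semidecidable (I := DoubleHead.Desc × DoubleHead.Desc)
        (fun d => d.1.Deterministic ∧ d.2.Deterministic)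
        (fun d => d.1.language ∩ d.2.language = ∅)) ∧
    (¬ DoubleHead.Semidecidable (I := DoubleHead.Desc × DoubleHead.Desc)
        (fun d => d.1.Deterministic ∧ d.2.Deterministic)
        (fun d => d.1.language ⊆ d.2.language)) ∧
    (∀ (Q T : Type) [Finite Q] [Finite T] (M : DoubleHead.TM Q T),
      ∃ L₁ L₂ : Set (List (DoubleHead.CompSymbol Q T)),
        DoubleHead.AcceptedByDet L₁ ∧ DoubleHead.AcceptedByDet L₂ ∧
        M.validComputations = L₁ ∩ L₂) := by
  obtain ⟨d₁, d₁', d₂, h₁, h₁', h₂, hd₂, hsub, hre⟩ := DoubleHead.exists_reduction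
  refine ⟨fun h => hre ?_, fun h => hre ?_, fun Q T _ _ M => M.exists_acceptedByDet⟩
  · have h' : REPred fun m => (d₁.Deterministic ∧ (d₂ m).Deterministic) ∧
        d₁.language ∩ (d₂ m).language = ∅ :=
      Partrec.comp h (Computable.pair (Computable.const d₁) hd₂)
    exact h'.of_eq fun m => and_iff_right ⟨h₁, h₂ m⟩
  · have h' : REPred fun m => ((d₂ m).Deterministic ∧ d₁'.Deterministic) ∧
        (d₂ m).language ⊆ d₁'.language :=
      Partrec.comp h (Computable.pair hd₂ (Computable.const d₁'))
    exact h'.of_eq fun m => (and_iff_right ⟨h₂ m, h₁'⟩).trans (hsub m)
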